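/- **Lemma A.1.** Let $H$ be a separable real Hilbert space and let $F\colon D(F)\subset H\to H$ be a (single-valued, possibly nonlinear) m-dissipative operator, i.e. $\langle Fx-Fy,x-y\rangle\le 0$ for all $x,y\in D(F)$ and $(I-\lambda F)(D(F))=H$ for all $\lambda>0$ (equivalently, $-F$ is m-accretive). Let $E$ be a real Hilbert space and $B\colon E\to H$ a bounded linear operator with $\operatorname{Ker}(B^*)=\{0\}$. Let $\{e_i\}$ be an orthonormal basis of $H$, let $P_n$ be the orthogonal projection onto $E_n:=\operatorname{span}(e_1,\dots,e_n)$, and suppose that $E_n\subset D(F)$ and that $F_n:=P_nF|_{E_n}\colon E_n\to E_n$ is continuous, for every $n$. Let $T>0$. For $y_0\in\overline{D(F)}$ and $u\in L^2(0,T;E)$ consider $$y'=Fy+Bu \ \text{ on } [0,T],\qquad y(0)=y_0, \tag{1}$$ $$y_n'=F_ny_n+P_nBu\ \text{ on } [0,T],\qquad y_n(0)=P_ny_0. \tag{2}$$ A solution of (2) is an absolutely continuous function satisfying the equation almost everywhere. A solution of (1) is understood in the generalized (mild) sense: it is a function $y$ with $y(0)=y_0$ that is the uniform limit on $[0,T]$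 of absolutely continuous functions $z_k$ such that, for a.e. $t$, $z_k(t)\in D(F)$ and $z_k'(t)=Fz_k(t)+g_k(t)$, where $g_k\to Bu$ in $L^1(0,T;H)$. Then there is a function $\delta\colon(0,\infty)\to[0,\infty)$ with $\lim_{\varepsilon\to0^+}\delta(\varepsilon)=0$ such that for all $\varepsilon>0$ and $y_0,y_1\in\overline{D(F)}$ there exist controls $u_n^\varepsilon$ ($n\in\mathbb N$) and $u^\varepsilon$ in $L^2(0,T;E)$ with the following properties: - $u_n^\varepsilon\to u^\varepsilon$ in $L^2(0,T;E)$ as $n\to\infty$; - for every $n$, equation (2) with $u=u_n^\varepsilon$ has a unique solution $y_n$, and $|y_n(T)-P_ny_1|_H\le\delta(\varepsilon)$; - equation (1) with $u=u^\varepsilon$ has a unique solution $y^{u^\varepsilon}$, and $|y^{u^\varepsilon}(T)-y_1|_H\le\delta(\varepsilon)$. -/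

import Mathlib

open MeasureTheory Filter Topology Set
open scoped InnerProductSpace

noncomputable section

/-- `F`, with domain `D`, is a (single-valued, nonlinear) m-dissipative operator, i.e. `-F` is
m-accretive: `-F` is accretive (monotone) and `I - lam F` maps `D` onto the whole space for every
`lam > 0`. Only the values of `F` on `D` matter. -/
structure IsMDissipative {X : Type*} [NormedAddCommGroup X] [InnerProductSpace ℝ X]
    (D : Set X) (F : X → X) : Prop where
  dissipative : ∀ x ∈ D, ∀ y ∈ D, ⟪F x - F y, x - y⟫_ℝ ≤ 0
  range_eq : ∀ lam : ℝ, 0 < lam → ∀ z : X, ∃ x ∈ D, x - lam • F x = z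

/-- `y` is a strong solution on `[0, T]` of `y' = F y + f`, `y 0 = x₀`, where `F` has domain `D`:
`y` is absolutely continuous, `y t ∈ D` and `y' t = F (y t) + f t` for almost every `t`
(written in integrated form). -/
structure IsStrongSolution {X : Type*} [NormedAddCommGroup X] [InnerProductSpace ℝ X]
    (D : Set X) (F : X → X) (f : ℝ → X) (T : ℝ) (x₀ : X) (y : ℝ → X) : Prop where
  ae_mem : ∀ᵐ t ∂(volume.restrict (Icc 0 T)), y t ∈ D
  integrableOn : IntegrableOn (fun t => F (y t) + f t) (Icc 0 T)
  eq_integral : ∀ t ∈ Icc 0 T, y t = x₀ + ∫ s in (0 : ℝ)..t, (F (y s) + f s)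

/-- `y` is a generalized (weak, equivalently mild) solution on `[0, T]` of `y' = F y + f`,
`y 0 = x₀`, with `f` integrable: it is the uniform limit on `[0, T]` of strong solutions `z k` of
`(z k)' = F (z k) + g k`, where `g k → f` in `L¹(0, T; X)`. -/
structure IsGeneralizedSolution {X : Type*} [NormedAddCommGroup X] [InnerProductSpace ℝ X]
    (D : Set X) (F : X → X) (f : ℝ → X) (T : ℝ) (x₀ : X) (y : ℝ → X) : Prop where
  integrableOn : IntegrableOn f (Icc 0 T)
  initial : y 0 = x₀
  approx : ∃ (g : ℕ → ℝ → X) (z : ℕ → ℝ → X),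
    (∀ k, IntegrableOn (g k) (Icc 0 T)) ∧
    (∀ k, IsStrongSolution D F (g k) T (z k 0) (z k)) ∧
    Tendsto (fun k => ∫ t in Icc 0 T, ‖g k t - f t‖) atTop (𝓝 0) ∧
    TendstoUniformlyOn z y atTop (Icc 0 T)

/-- The span `E_n` of the first `n` vectors of an orthonormal basis `(e i)`, `i < N`, of a
separable Hilbert space of dimension `N ≤ ∞`. -/
def galerkinSpace {H : Type*} [NormedAddCommGroup H] [InnerProductSpace ℝ H]
    {N : ℕ∞} (e : HilbertBasis {i : ℕ // (i : ℕ∞) < N} ℝ H) (n : ℕ) : Submodule ℝ H :=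
  Submodule.span ℝ (e '' {i | (i : ℕ) < n})

instance galerkinSpace_finiteDimensional {H : Type*} [NormedAddCommGroup H]
    [InnerProductSpace ℝ H] {N : ℕ∞} (e : HilbertBasis {i : ℕ // (i : ℕ∞) < N} ℝ H) (n : ℕ) :
    FiniteDimensional ℝ (galerkinSpace e n) := by
  apply FiniteDimensional.span_of_finite
  apply Set.Finite.image
  exact Set.Finite.preimage Subtype.val_injective.injOn (Set.finite_lt_nat n)

/-- The orthogonal projection `P_n` of `H` onto `E_n`, as an operator on `H`. -/
def galerkinProj {H : Type*} [NormedAddCommGroup H] [InnerProductSpace ℝ H]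
    {N : ℕ∞} (e : HilbertBasis {i : ℕ // (i : ℕ∞) < N} ℝ H) (n : ℕ) : H →L[ℝ] H :=
  (galerkinSpace e n).starProjection

end

/-! A finite-dimensional trajectory does the steering; the rest is stability of dissipative
equations under perturbation of data and forcing.

Put a = P_m y₀ and b = P_m y₁ with m so large that each endpoint moves by less than ε/8. The segment
from a to b lies in E_m ⊂ D, so a parametrization z of it satisfies z' = Fz + g with g := z' − Fz.
Along the segment F is a pointwise limit of continuous maps P_nF, hence measurable but perhaps not
integrable; a suitable parametrization makes g integrable (`exists_timeChange_integrableOn_comp`).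
Since Ker B* = 0, B has dense range, and g lies within ε/8 in L¹ of Bw for some Lipschitz w
(`exists_lipschitzWith_integral_norm_sub_le`).

This one w serves the full equation and every Galerkin equation with n ≥ m, because z stays in E_n
and thus solves the n-th Galerkin equation with forcing P_n g. By dissipativity, two solutions
differ by at most the distance of their data plus twice the L¹ distance of their forcings
(`IsStrongSolution.norm_sub_le`, `IsGeneralizedSolution.norm_sub_le`), so all endpoint errors are
below ε. The finitely many systems with n < m are controlled exactly. Hence the controls are
eventually equal to w, and δ(ε) = ε works.

Existence for Lipschitz forcing is Kato's theorem (`IsMDissipative.exists_isStrongSolution`), by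
Yosida approximation and demiclosedness. It covers F_n as well, since a continuous dissipative map
on a finite-dimensional space is m-dissipative (`isMDissipative_univ_of_continuous`). -/

/-! ### Picard iteration for Lipschitz equations. -/

/-- Global solvability of `y' = G y + f` for a globally Lipschitz `G`. -/
theorem exists_integral_eq_of_lipschitz {X : Type*} [NormedAddCommGroup X] [NormedSpace ℝ X]
    [CompleteSpace X] {G : X → X} {K : NNReal} (hG : LipschitzWith K G) {f : ℝ → X}
    (hf : Continuous f) (x₀ : X) {S : ℝ} (hS : 0 ≤ S) :
    ∃ y : ℝ → X, Continuous y ∧ ∀ t ∈ Icc 0 S, y t = x₀ + ∫ s in (0 : ℝ)..t, (G (y s) + f s) := by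
  -- The unknown is w(t) = exp(-kt) y(t), i.e. the sup norm is exponentially weighted. With k = K +
  -- 1 the Picard map has Lipschitz constant K/(K+1) < 1 whatever the length `S`, so no gluing of
  -- short intervals is needed.
  set k : ℝ := K + 1 with hk
  have hk0 : 0 < k := by positivity
  let P : C(Icc 0 S, X) → ℝ → X := fun w t =>
    x₀ + ∫ s in (0 : ℝ)..t, (G (Real.exp (k * s) • IccExtend hS w s) + f s)
  have hint : ∀ w : C(Icc 0 S, X),
      Continuous fun s => G (Real.exp (k * s) • IccExtend hS w s) + f s := by
    intro w
    have := w.continuous.Icc_extend' (h := hS)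
    have hc : Continuous fun s => Real.exp (k * s) • IccExtend hS w s := by fun_prop
    exact (hG.continuous.comp hc).add hf
  have hP : ∀ w, Continuous (P w) := fun w =>
    continuous_const.add
      (intervalIntegral.continuous_primitive (fun a b => (hint w).intervalIntegrable a b) 0)
  let Φ : C(Icc 0 S, X) → C(Icc 0 S, X) := fun w =>
    ⟨fun t => Real.exp (-(k * t)) • P w t, by
      have := (hP w).comp (continuous_subtype_val (p := fun t => t ∈ Icc 0 S))
      have h2 : Continuous fun t : Icc 0 S => Real.exp (-(k * t)) := by fun_prop
      exact h2.smul this⟩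
  have hΦ : ContractingWith (K / (K + 1)) Φ := by
    refine ⟨?_, LipschitzWith.of_dist_le_mul fun w w' => ?_⟩
    · rw [div_lt_one (by positivity)]
      simp
    · refine (ContinuousMap.dist_le (by positivity)).2 fun t => ?_
      have ht := t.2
      have h1 : dist (Φ w t) (Φ w' t) = Real.exp (-(k * t)) *
          ‖∫ s in (0 : ℝ)..t, ((G (Real.exp (k * s) • IccExtend hS w s) + f s) -
            (G (Real.exp (k * s) • IccExtend hS w' s) + f s))‖ := by
        rw [intervalIntegral.integral_sub ((hint w).intervalIntegrable _ _)
          ((hint w').intervalIntegrable _ _), dist_eq_norm]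
        simp only [Φ, P, ContinuousMap.coe_mk]
        rw [← smul_sub, norm_smul, Real.norm_eq_abs, Real.abs_exp, add_sub_add_left_eq_sub]
      have h2 : ‖∫ s in (0 : ℝ)..t, ((G (Real.exp (k * s) • IccExtend hS w s) + f s) -
            (G (Real.exp (k * s) • IccExtend hS w' s) + f s))‖ ≤
          ∫ s in (0 : ℝ)..t, (K * dist w w') * Real.exp (k * s) := by
        refine intervalIntegral.norm_integral_le_of_norm_le ht.1 (ae_of_all _ fun s _ => ?_)
          (Continuous.intervalIntegrable (by fun_prop) _ _)
        rw [add_sub_add_right_eq_sub, ← dist_eq_norm]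
        refine (hG.dist_le_mul _ _).trans ?_
        rw [dist_smul₀, Real.norm_eq_abs, Real.abs_exp]
        have : dist (IccExtend hS w s) (IccExtend hS w' s) ≤ dist w w' :=
          ContinuousMap.dist_apply_le_dist _
        calc (K : ℝ) * (Real.exp (k * s) * _) ≤ K * (Real.exp (k * s) * dist w w') := by gcongr
          _ = _ := by ring
      have h3 : ∫ s in (0 : ℝ)..t, (K * dist w w') * Real.exp (k * s) =
          (K * dist w w') * ((Real.exp (k * t) - 1) / k) := by
        rw [intervalIntegral.integral_const_mul,
          intervalIntegral.integral_comp_mul_left (fun s => Real.exp s) hk0.ne', integral_exp]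
        simp [div_eq_inv_mul]
      rw [h1]
      refine (mul_le_mul_of_nonneg_left (h2.trans h3.le) (Real.exp_pos _).le).trans ?_
      have h4 : Real.exp (-(k * t)) * Real.exp (k * t) = 1 := by
        rw [← Real.exp_add]; simp
      have h5 : Real.exp (-(k * t)) * (K * dist w w' * ((Real.exp (k * t) - 1) / k)) =
          K * dist w w' / k * (1 - Real.exp (-(k * t))) := by
        have : Real.exp (-(k * t)) * (K * dist w w' * ((Real.exp (k * t) - 1) / k)) =
          K * dist w w' / k * (Real.exp (-(k * t)) * Real.exp (k * t) - Real.exp (-(k * t))) := by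
          ring
        rw [this, h4]
      rw [h5]
      have h6 : 0 ≤ K * dist w w' / k := by positivity
      have h7 : ((K / (K + 1) : NNReal) : ℝ) * dist w w' = K * dist w w' / k := by
        push_cast
        rw [hk]; ring
      rw [h7]
      nlinarith [Real.exp_pos (-(k * (t : ℝ)))]
  have : Nonempty (Icc 0 S) := ⟨⟨0, le_rfl, hS⟩⟩
  obtain ⟨w, hw⟩ : ∃ w, Φ w = w := ⟨hΦ.fixedPoint, hΦ.fixedPoint_isFixedPt⟩
  refine ⟨P w, hP w, fun t ht => ?_⟩
  have key : ∀ s ∈ Icc 0 S, Real.exp (k * s) • IccExtend hS w s = P w s := by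
    intro s hs
    rw [IccExtend_of_mem hS w hs]
    conv_lhs => rw [← hw]
    simp only [Φ, ContinuousMap.coe_mk, smul_smul]
    rw [← Real.exp_add]; simp
  change x₀ + _ = _
  congr 1
  refine intervalIntegral.integral_congr fun s hs => ?_
  rw [uIcc_of_le ht.1] at hs
  rw [key s ⟨hs.1, hs.2.trans ht.2⟩]

/-! ### Energy identity and growth bound for absolutely continuous curves. -/

section Energy

variable {X : Type*} [NormedAddCommGroup X] [InnerProductSpace ℝ X]

theorem norm_primitive_sub_le [CompleteSpace X] {v v' : ℝ → X} {T : ℝ}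
    (hv : IntegrableOn v (Icc 0 T)) (hv' : IntegrableOn v' (Icc 0 T)) {t : ℝ} (ht : t ∈ Icc 0 T) :
    ‖(∫ s in (0 : ℝ)..t, v s) - ∫ s in (0 : ℝ)..t, v' s‖ ≤ ∫ s in Icc 0 T, ‖v s - v' s‖ := by
  have hsub : uIcc 0 t ⊆ Icc 0 T := by rw [uIcc_of_le ht.1]; exact Icc_subset_Icc_right ht.2
  rw [← intervalIntegral.integral_sub (hv.mono_set hsub).intervalIntegrable
    (hv'.mono_set hsub).intervalIntegrable]
  refine (intervalIntegral.norm_integral_le_integral_norm ht.1).trans ?_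
  rw [intervalIntegral.integral_of_le ht.1]
  exact setIntegral_mono_set (hv.sub hv').norm (ae_of_all _ fun _ => norm_nonneg _)
    (Ioc_subset_Icc_self.trans (Icc_subset_Icc_right ht.2)).eventuallyLE

theorem norm_primitive_le [CompleteSpace X] {v : ℝ → X} {T : ℝ}
    (hv : IntegrableOn v (Icc 0 T)) {t : ℝ} (ht : t ∈ Icc 0 T) :
    ‖∫ s in (0 : ℝ)..t, v s‖ ≤ ∫ s in Icc 0 T, ‖v s‖ := by
  simpa using norm_primitive_sub_le hv (v' := fun _ => 0) integrableOn_zero ht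

theorem continuousOn_add_primitive {v : ℝ → X} {T : ℝ} (hT : 0 ≤ T)
    (hv : IntegrableOn v (Icc 0 T)) (w₀ : X) :
    ContinuousOn (fun t => w₀ + ∫ s in (0 : ℝ)..t, v s) (Icc 0 T) := by
  have := intervalIntegral.continuousOn_primitive_interval (μ := volume) (f := v) (a := 0) (b := T)
    (by rwa [uIcc_of_le hT])
  rw [uIcc_of_le hT] at this
  exact continuousOn_const.add this

theorem norm_sq_add_primitive_of_continuous [CompleteSpace X] {v : ℝ → X} (hv : Continuous v)
    (w₀ : X) (t : ℝ) :
    ‖w₀ + ∫ s in (0 : ℝ)..t, v s‖ ^ 2 =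
      ‖w₀‖ ^ 2 + 2 * ∫ s in (0 : ℝ)..t, ⟪v s, w₀ + ∫ r in (0 : ℝ)..s, v r⟫_ℝ := by
  set w : ℝ → X := fun t => w₀ + ∫ s in (0 : ℝ)..t, v s with hw
  have hd : ∀ s, HasDerivAt w (v s) s := fun s =>
    (hv.integral_hasStrictDerivAt 0 s).hasDerivAt.const_add w₀
  have hwc : Continuous w := continuous_iff_continuousAt.2 fun s => (hd s).continuousAt
  have h := intervalIntegral.integral_eq_sub_of_hasDerivAt (a := 0) (b := t)
    (f := fun s => ‖w s‖ ^ 2) (f' := fun s => 2 * ⟪v s, w s⟫_ℝ)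
    (fun s _ => by
      have := (hd s).norm_sq
      rwa [real_inner_comm] at this)
    (Continuous.intervalIntegrable (by fun_prop) _ _)
  rw [intervalIntegral.integral_const_mul] at h
  have h0 : w 0 = w₀ := by simp [hw]
  rw [h0] at h
  change ‖w t‖ ^ 2 = ‖w₀‖ ^ 2 + 2 * ∫ s in (0 : ℝ)..t, ⟪v s, w s⟫_ℝ
  linarith

theorem integrableOn_inner_of_continuousOn {v w : ℝ → X} {T : ℝ} (hv : IntegrableOn v (Icc 0 T))
    (hw : ContinuousOn w (Icc 0 T)) : IntegrableOn (fun s => ⟪v s, w s⟫_ℝ) (Icc 0 T) := by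
  obtain ⟨M, hM⟩ := isCompact_Icc.exists_bound_of_continuousOn hw
  have hws : AEStronglyMeasurable w (volume.restrict (Icc 0 T)) :=
    hw.aestronglyMeasurable_of_isCompact isCompact_Icc measurableSet_Icc
  refine Integrable.mono' (hv.norm.mul_const M) (hv.aestronglyMeasurable.inner hws) ?_
  filter_upwards [ae_restrict_mem measurableSet_Icc] with s hs
  exact (norm_inner_le_norm _ _).trans (mul_le_mul_of_nonneg_left (hM s hs) (norm_nonneg _))

/-- Energy identity for absolutely continuous functions. -/
theorem norm_sq_add_primitive [CompleteSpace X] {v : ℝ → X} {T : ℝ}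
    (hv : IntegrableOn v (Icc 0 T)) (w₀ : X) {t : ℝ} (ht : t ∈ Icc 0 T) :
    ‖w₀ + ∫ s in (0 : ℝ)..t, v s‖ ^ 2 =
      ‖w₀‖ ^ 2 + 2 * ∫ s in (0 : ℝ)..t, ⟪v s, w₀ + ∫ r in (0 : ℝ)..s, v r⟫_ℝ := by
  have hT : 0 ≤ T := ht.1.trans ht.2
  set V : ℝ := ∫ s in Icc 0 T, ‖v s‖ with hV
  have hV0 : 0 ≤ V := integral_nonneg fun _ => norm_nonneg _
  -- The extra 1 lets `M` also bound the approximating curve `w'`, as `η ≤ 1`.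
  set M : ℝ := ‖w₀‖ + V + 1 with hM
  set w : ℝ → X := fun t => w₀ + ∫ s in (0 : ℝ)..t, v s with hw
  have hwM : ∀ s ∈ Icc 0 T, ‖w s‖ ≤ M := fun s hs =>
    (norm_add_le _ _).trans (by linarith [norm_primitive_le hv hs])
  have hwc := continuousOn_add_primitive hT hv w₀
  -- Replacing `v` by a continuous function at L¹ distance at most `η` costs 2Mη in the square and
  -- twice 2Mη in the doubled integral.
  suffices h : ∀ η : ℝ, 0 < η → η ≤ 1 →
      |‖w t‖ ^ 2 - (‖w₀‖ ^ 2 + 2 * ∫ s in (0 : ℝ)..t, ⟪v s, w s⟫_ℝ)| ≤ 6 * M * η by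
    have h0 : |‖w t‖ ^ 2 - (‖w₀‖ ^ 2 + 2 * ∫ s in (0 : ℝ)..t, ⟪v s, w s⟫_ℝ)| ≤ 0 := by
      have hlim : Tendsto (fun η : ℝ => 6 * M * η) (𝓝[>] 0) (𝓝 0) := by
        have : Tendsto (fun η : ℝ => 6 * M * η) (𝓝 0) (𝓝 (6 * M * 0)) :=
          (continuous_const.mul continuous_id).tendsto 0
        rw [mul_zero] at this
        exact this.mono_left nhdsWithin_le_nhds
      refine ge_of_tendsto hlim ?_
      filter_upwards [Ioc_mem_nhdsGT (zero_lt_one' ℝ)] with η hη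
      exact h η hη.1 hη.2
    linarith [abs_nonpos_iff.1 h0]
  intro η hη hη1
  obtain ⟨v', -, hvv', hv'c, hv'i⟩ := hv.exists_hasCompactSupport_integral_sub_le hη
  have hv'i : IntegrableOn v' (Icc 0 T) := hv'i
  set w' : ℝ → X := fun t => w₀ + ∫ s in (0 : ℝ)..t, v' s with hw'
  have hw'c : ContinuousOn w' (Icc 0 T) := continuousOn_add_primitive hT hv'i w₀
  have hww' : ∀ s ∈ Icc 0 T, ‖w s - w' s‖ ≤ η := fun s hs => by
    simp only [hw, hw', add_sub_add_left_eq_sub]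
    exact (norm_primitive_sub_le hv hv'i hs).trans hvv'
  have hV' : ∫ s in Icc 0 T, ‖v' s‖ ≤ V + η := by
    have : ∫ s in Icc 0 T, ‖v' s‖ ≤ ∫ s in Icc 0 T, (‖v s‖ + ‖v s - v' s‖) := by
      refine integral_mono hv'i.norm (hv.norm.add (hv.sub hv'i).norm) fun s => ?_
      have := norm_sub_norm_le (v' s) (v s)
      rw [norm_sub_rev] at this
      simp only
      linarith
    have hi := integral_add hv.norm (hv.sub hv'i).norm
    simp only [Pi.sub_apply] at hi
    linarith
  have hw'M : ∀ s ∈ Icc 0 T, ‖w' s‖ ≤ M := fun s hs =>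
    (norm_add_le _ _).trans (by linarith [norm_primitive_le hv'i hs])
  have e1 := norm_sq_add_primitive_of_continuous hv'c w₀ t
  change ‖w' t‖ ^ 2 = ‖w₀‖ ^ 2 + 2 * ∫ s in (0 : ℝ)..t, ⟪v' s, w' s⟫_ℝ at e1
  have e2 : |‖w t‖ ^ 2 - ‖w' t‖ ^ 2| ≤ 2 * M * η := by
    have h1 : |‖w t‖ - ‖w' t‖| ≤ η := (abs_norm_sub_norm_le _ _).trans (hww' t ht)
    have h2 : ‖w t‖ ^ 2 - ‖w' t‖ ^ 2 = (‖w t‖ + ‖w' t‖) * (‖w t‖ - ‖w' t‖) := by ring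
    rw [h2, abs_mul, abs_of_nonneg (by positivity)]
    exact mul_le_mul (by linarith [hwM t ht, hw'M t ht]) h1 (abs_nonneg _) (by positivity)
  have i1 := integrableOn_inner_of_continuousOn hv hwc
  have i2 := integrableOn_inner_of_continuousOn hv'i hw'c
  have hsub : uIcc 0 t ⊆ Icc 0 T := by rw [uIcc_of_le ht.1]; exact Icc_subset_Icc_right ht.2
  have e3 : |(∫ s in (0 : ℝ)..t, ⟪v s, w s⟫_ℝ) - ∫ s in (0 : ℝ)..t, ⟪v' s, w' s⟫_ℝ| ≤
      2 * M * η := by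
    have := norm_primitive_sub_le i1 i2 ht
    rw [Real.norm_eq_abs] at this
    refine this.trans ?_
    calc ∫ s in Icc 0 T, ‖⟪v s, w s⟫_ℝ - ⟪v' s, w' s⟫_ℝ‖
        ≤ ∫ s in Icc 0 T, (‖v s - v' s‖ * M + ‖v' s‖ * η) := by
          refine setIntegral_mono_on (i1.sub i2).norm
            (((hv.sub hv'i).norm.mul_const M).add (hv'i.norm.mul_const η)) measurableSet_Icc
            fun s hs => ?_
          have : ⟪v s, w s⟫_ℝ - ⟪v' s, w' s⟫_ℝ = ⟪v s - v' s, w s⟫_ℝ + ⟪v' s, w s - w' s⟫_ℝ := by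
            rw [inner_sub_left, inner_sub_right]; ring
          rw [this]
          refine (norm_add_le _ _).trans (add_le_add ?_ ?_)
          · exact (norm_inner_le_norm _ _).trans
              (mul_le_mul_of_nonneg_left (hwM s hs) (norm_nonneg _))
          · exact (norm_inner_le_norm _ _).trans
              (mul_le_mul_of_nonneg_left (hww' s hs) (norm_nonneg _))
      _ = (∫ s in Icc 0 T, ‖v s - v' s‖) * M + (∫ s in Icc 0 T, ‖v' s‖) * η := by
          have hi := integral_add ((hv.sub hv'i).norm.mul_const M) (hv'i.norm.mul_const η)
          simp only [Pi.sub_apply] at hi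
          rw [hi, integral_mul_const, integral_mul_const]
      _ ≤ η * M + M * η := by
          gcongr
          have := norm_nonneg w₀
          linarith
      _ = 2 * M * η := by ring
  rw [abs_le] at e2 e3 ⊢
  constructor <;> linarith [e2.1, e2.2, e3.1, e3.2]

/-- If `w' = v` and `⟪w', w⟫ ≤ r ‖w‖` almost everywhere, then `‖w‖` grows by at most
twice the integral of `r`. -/
theorem norm_le_of_inner_le [CompleteSpace X] {v w : ℝ → X} {r : ℝ → ℝ} {w₀ : X} {T : ℝ}
    (hv : IntegrableOn v (Icc 0 T))
    (hw : ∀ t ∈ Icc 0 T, w t = w₀ + ∫ s in (0 : ℝ)..t, v s)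
    (hr : IntegrableOn r (Icc 0 T)) (hr0 : ∀ s, 0 ≤ r s)
    (h : ∀ᵐ s ∂(volume.restrict (Icc 0 T)), ⟪v s, w s⟫_ℝ ≤ r s * ‖w s‖)
    {t : ℝ} (ht : t ∈ Icc 0 T) : ‖w t‖ ≤ ‖w₀‖ + 2 * ∫ s in Icc 0 T, r s := by
  have hT : 0 ≤ T := ht.1.trans ht.2
  set R := ∫ s in Icc 0 T, r s with hR
  have hR0 : 0 ≤ R := integral_nonneg hr0
  have hwc : ContinuousOn w (Icc 0 T) := (continuousOn_add_primitive hT hv w₀).congr hw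
  -- At a maximum point τ the energy identity reads ‖w τ‖² ≤ ‖w₀‖² + 2R‖w τ‖ ≤ (‖w₀‖ + 2R)‖w τ‖,
  -- which replaces a Gronwall argument. The factor 2 is not sharp, but harmless.
  obtain ⟨τ, hτ, hmax⟩ := isCompact_Icc.exists_isMaxOn ⟨t, ht⟩ hwc.norm
  have hmax' : ∀ s ∈ Icc 0 T, ‖w s‖ ≤ ‖w τ‖ := fun s hs => hmax hs
  have e := norm_sq_add_primitive hv w₀ hτ
  rw [← hw τ hτ] at e
  have e1 : ∫ s in (0 : ℝ)..τ, ⟪v s, w₀ + ∫ q in (0 : ℝ)..s, v q⟫_ℝ =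
      ∫ s in (0 : ℝ)..τ, ⟪v s, w s⟫_ℝ := by
    refine intervalIntegral.integral_congr fun s hs => ?_
    rw [uIcc_of_le hτ.1] at hs
    rw [hw s ⟨hs.1, hs.2.trans hτ.2⟩]
  rw [e1, intervalIntegral.integral_of_le hτ.1] at e
  have hsub : Ioc 0 τ ⊆ Icc 0 T := Ioc_subset_Icc_self.trans (Icc_subset_Icc_right hτ.2)
  have i1 := integrableOn_inner_of_continuousOn hv hwc
  have e2 : ∫ s in Ioc 0 τ, ⟪v s, w s⟫_ℝ ≤ ∫ s in Ioc 0 τ, r s * ‖w τ‖ := by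
    refine setIntegral_mono_ae_restrict (i1.mono_set hsub) ((hr.mono_set hsub).mul_const _) ?_
    filter_upwards [ae_restrict_of_ae_restrict_of_subset hsub h,
      ae_restrict_mem measurableSet_Ioc] with s hs hs'
    exact hs.trans (mul_le_mul_of_nonneg_left (hmax' s (hsub hs')) (hr0 s))
  have e3 : ∫ s in Ioc 0 τ, r s * ‖w τ‖ ≤ R * ‖w τ‖ := by
    rw [integral_mul_const]
    refine mul_le_mul_of_nonneg_right ?_ (norm_nonneg _)
    exact setIntegral_mono_set hr (ae_of_all _ hr0) hsub.eventuallyLE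
  have e4 : ‖w₀‖ ≤ ‖w τ‖ := by
    have := hmax' 0 ⟨le_rfl, hT⟩
    rwa [hw 0 ⟨le_rfl, hT⟩, intervalIntegral.integral_same, add_zero] at this
  refine (hmax' t ht).trans ?_
  by_contra! hlt
  nlinarith [norm_nonneg w₀, norm_nonneg (w τ)]

end Energy

/-! ### Maximality, demiclosedness, Yosida approximation and a priori bounds. -/

section MDissipative

variable {X : Type*} [NormedAddCommGroup X] [InnerProductSpace ℝ X]

/-- Minty's argument: solve x − Fx = y − η and test with this x, which gives ‖x − y‖² ≤ 0. -/
theorem IsMDissipative.mem_of_forall_inner_le {D : Set X} {F : X → X} (hF : IsMDissipative D F)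
    {y η : X} (h : ∀ x ∈ D, ⟪F x - η, x - y⟫_ℝ ≤ 0) : y ∈ D ∧ F y = η := by
  obtain ⟨x, hx, hxe⟩ := hF.range_eq 1 one_pos (y - η)
  have e : F x - η = x - y := by
    rw [one_smul] at hxe
    have : F x = x - (y - η) := by rw [← hxe]; abel
    rw [this]; abel
  have h1 := h x hx
  rw [e, real_inner_self_eq_norm_sq] at h1
  have h2 : ‖x - y‖ = 0 := by nlinarith [norm_nonneg (x - y)]
  have h3 : x = y := sub_eq_zero.1 (norm_eq_zero.1 h2)
  subst h3
  rw [sub_self, sub_eq_zero] at e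
  exact ⟨hx, e⟩

/-- Banach–Alaoglu transported by the Riesz isometry; ultrafilters take the place of weakly
convergent subsequences. -/
theorem exists_weak_limit_ultrafilter [CompleteSpace X] {ι : Type*} {a : ι → X} {C : ℝ}
    (ha : ∀ k, ‖a k‖ ≤ C) (U : Ultrafilter ι) :
    ∃ η : X, ∀ h : X, Tendsto (fun k => ⟪h, a k⟫_ℝ) U (𝓝 ⟪h, η⟫_ℝ) := by
  have hK := WeakDual.isCompact_closedBall (𝕜 := ℝ) (0 : StrongDual ℝ X) C
  let φ : ι → WeakDual ℝ X := fun k => StrongDual.toWeakDual (InnerProductSpace.toDual ℝ X (a k))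
  have hφ : ∀ k, φ k ∈ WeakDual.toStrongDual ⁻¹' Metric.closedBall (0 : StrongDual ℝ X) C := by
    intro k
    simp only [mem_preimage, mem_closedBall_zero_iff]
    exact ((InnerProductSpace.toDual ℝ X).norm_map (a k)).trans_le (ha k)
  obtain ⟨ξ, -, hξ⟩ := hK.ultrafilter_le_nhds' (U.map φ)
    (Ultrafilter.mem_map.2 (Filter.univ_mem' hφ))
  refine ⟨(InnerProductSpace.toDual ℝ X).symm (WeakDual.toStrongDual ξ), fun h => ?_⟩
  have h1 : Tendsto φ U (𝓝 ξ) := hξ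
  have h2 := ((WeakDual.eval_continuous h).tendsto ξ).comp h1
  rw [real_inner_comm, InnerProductSpace.toDual_symm_apply]
  refine h2.congr fun k => ?_
  simp only [Function.comp_apply]
  rw [real_inner_comm]
  rfl

theorem IsMDissipative.demiclosed [CompleteSpace X] {D : Set X} {F : X → X}
    (hF : IsMDissipative D F) {x : ℕ → X} {y : X} {C : ℝ} (hx : ∀ k, x k ∈ D)
    (hxy : Tendsto x atTop (𝓝 y)) (hC : ∀ k, ‖F (x k)‖ ≤ C) :
    y ∈ D ∧ ∀ h : X, Tendsto (fun k => ⟪h, F (x k)⟫_ℝ) atTop (𝓝 ⟪h, F y⟫_ℝ) := by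
  have key : ∀ U : Ultrafilter ℕ, (U : Filter ℕ) ≤ atTop →
      y ∈ D ∧ ∀ h : X, Tendsto (fun k => ⟪h, F (x k)⟫_ℝ) U (𝓝 ⟪h, F y⟫_ℝ) := by
    intro U hU
    obtain ⟨η, hη⟩ := exists_weak_limit_ultrafilter hC U
    have hxU : Tendsto x U (𝓝 y) := hxy.mono_left hU
    have hm := hF.mem_of_forall_inner_le (y := y) (η := η) fun z hz => by
      -- Dissipativity with z − x_k split as (z − y) + (y − x_k) next to F x_k: the first part
      -- passes to the weak limit, the second vanishes since F x_k is bounded and x_k → y strongly.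
      have e : ∀ k, ⟪F z, z - x k⟫_ℝ - ⟪z - y, F (x k)⟫_ℝ - ⟪F (x k), y - x k⟫_ℝ ≤ 0 := by
        intro k
        refine le_of_eq_of_le ?_ (hF.dissipative z hz (x k) (hx k))
        rw [real_inner_comm (F (x k)) (z - y), sub_sub, ← inner_add_right, inner_sub_left]
        congr 2
        abel
      have t1 : Tendsto (fun k => ⟪F z, z - x k⟫_ℝ) U (𝓝 ⟪F z, z - y⟫_ℝ) :=
        tendsto_const_nhds.inner (tendsto_const_nhds.sub hxU)
      have t3 : Tendsto (fun k => ⟪F (x k), y - x k⟫_ℝ) U (𝓝 0) := by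
        refine squeeze_zero_norm (a := fun k => C * ‖y - x k‖) (fun k => ?_) ?_
        · exact (norm_inner_le_norm _ _).trans
            (mul_le_mul_of_nonneg_right (hC k) (norm_nonneg _))
        · have := (tendsto_const_nhds (x := y)).sub hxU
          rw [sub_self] at this
          simpa using this.norm.const_mul C
      have := le_of_tendsto ((t1.sub (hη (z - y))).sub t3) (Eventually.of_forall e)
      rw [inner_sub_left, real_inner_comm (z - y) η]
      linarith
    exact ⟨hm.1, hm.2 ▸ hη⟩
  -- Every ultrafilter finer than `atTop` yields the same limit F y, so the whole sequence converges
  -- weakly.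
  obtain ⟨U, hU⟩ := Ultrafilter.exists_le (atTop : Filter ℕ)
  exact ⟨(key U hU).1, fun h => tendsto_iff_ultrafilter _ _ _ |>.2 fun V hV => (key V hV).2 h⟩

/-- The resolvent `J` of an m-dissipative operator; `F ∘ J` is the Yosida approximation. -/
theorem IsMDissipative.exists_resolvent {D : Set X} {F : X → X} (hF : IsMDissipative D F)
    {lam : ℝ} (hl : 0 < lam) :
    ∃ J : X → X, (∀ z, J z ∈ D) ∧ (∀ z, J z - lam • F (J z) = z) ∧
      (∃ K : NNReal, LipschitzWith K fun z => F (J z)) ∧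
      (∀ z z', ⟪F (J z) - F (J z'), z - z'⟫_ℝ ≤ 0) ∧ ∀ x ∈ D, ‖F (J x)‖ ≤ ‖F x‖ := by
  choose J hJD hJ using hF.range_eq lam hl
  have hz : ∀ z z', z - z' = (J z - J z') - lam • (F (J z) - F (J z')) := fun z z' => by
    conv_lhs => rw [← hJ z, ← hJ z']
    rw [smul_sub]; abel
  have hdis : ∀ z z', ⟪F (J z) - F (J z'), J z - J z'⟫_ℝ ≤ 0 := fun z z' =>
    hF.dissipative _ (hJD z) _ (hJD z')
  -- Cocoercivity of the Yosida approximation; Cauchy–Schwarz then gives the Lipschitz constant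
  -- 1/lam.
  have hq : ∀ z z', ⟪F (J z) - F (J z'), z - z'⟫_ℝ ≤ -(lam * ‖F (J z) - F (J z')‖ ^ 2) := by
    intro z z'
    rw [hz z z', inner_sub_right, inner_smul_right, real_inner_self_eq_norm_sq]
    linarith [hdis z z']
  refine ⟨J, hJD, hJ, ⟨(⟨lam, hl.le⟩ : NNReal)⁻¹, LipschitzWith.of_dist_le_mul fun z z' => ?_⟩,
    fun z z' => (hq z z').trans (by have := sq_nonneg ‖F (J z) - F (J z')‖; nlinarith), ?_⟩
  · rw [dist_eq_norm, dist_eq_norm]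
    have h1 := hq z z'
    have h2 := abs_le.1 (abs_real_inner_le_norm (F (J z) - F (J z')) (z - z'))
    change ‖F (J z) - F (J z')‖ ≤ lam⁻¹ * ‖z - z'‖
    rw [← div_eq_inv_mul, le_div_iff₀ hl]
    by_contra! hlt
    have h3 : 0 ≤ ‖F (J z) - F (J z')‖ := norm_nonneg _
    have h4 : 0 < ‖F (J z) - F (J z')‖ := by
      rcases h3.lt_or_eq with h | h
      · exact h
      · rw [← h] at hlt; linarith [norm_nonneg (z - z')]
    nlinarith [mul_lt_mul_of_pos_left hlt h4]
  -- Since J x − x = lam F(J x), dissipativity between J x and x says ‖F(J x)‖² ≤ ⟪F x, F(J x)⟫.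
  · intro x hx
    have h1 := hF.dissipative _ (hJD x) x hx
    have h2 : J x - x = lam • F (J x) := by
      have := hJ x
      rw [sub_eq_iff_eq_add] at this
      rw [sub_eq_iff_eq_add', ← this]
    rw [h2, inner_smul_right, inner_sub_left, real_inner_self_eq_norm_sq] at h1
    have h3 := real_inner_le_norm (F x) (F (J x))
    by_contra! hlt
    have h4 : 0 < ‖F (J x)‖ := (norm_nonneg _).trans_lt hlt
    have h5 : ‖F (J x)‖ ^ 2 - ⟪F x, F (J x)⟫_ℝ ≤ 0 := by
      by_contra! h; nlinarith [mul_pos hl h]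
    nlinarith

/-- Lipschitz-in-time bound for `y' = A y + f` with `A` dissipative, uniform in `A`. -/
theorem norm_velocity_le [CompleteSpace X] {A : X → X} (hAc : Continuous A)
    (hA : ∀ z z', ⟪A z - A z', z - z'⟫_ℝ ≤ 0) {f : ℝ → X} {L : NNReal} (hf : LipschitzWith L f)
    {T M N : ℝ} (hN : 0 ≤ N) (hM : ∀ t ∈ Icc 0 (T + 1), ‖f t‖ ≤ M) {x₀ : X} (hx₀ : ‖A x₀‖ ≤ N)
    {y : ℝ → X} (hyc : Continuous y)
    (hy : ∀ t ∈ Icc 0 (T + 1), y t = x₀ + ∫ s in (0 : ℝ)..t, (A (y s) + f s))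
    {t : ℝ} (ht : t ∈ Icc 0 T) : ‖A (y t)‖ ≤ 2 * (N + M) + 2 * (L * T) + M := by
  have hT : 0 ≤ T := ht.1.trans ht.2
  have hM0 : 0 ≤ M := (norm_nonneg _).trans (hM 0 ⟨le_rfl, by linarith⟩)
  set v : ℝ → X := fun s => A (y s) + f s with hv
  have hvc : Continuous v := (hAc.comp hyc).add hf.continuous
  have hvi : ∀ a b, IntervalIntegrable v volume a b := fun a b => hvc.intervalIntegrable a b
  -- Compare `y` with the constant curve `x₀`, which solves the equation with forcing −A x₀.
  have start : ∀ h ∈ Icc (0 : ℝ) 1, ‖y h - x₀‖ ≤ 2 * (N + M) * h := by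
    intro h hh
    have hsub : Icc 0 h ⊆ Icc 0 (T + 1) := Icc_subset_Icc_right (by linarith [hh.2])
    have := norm_le_of_inner_le (v := v) (w := fun t => y t - x₀) (r := fun _ => N + M) (w₀ := 0)
      (T := h) (hvc.integrableOn_Icc) (fun t ht => by simp [hy t (hsub ht), hv])
      (integrableOn_const (by simp)) (fun _ => by linarith) (by
        filter_upwards [ae_restrict_mem measurableSet_Icc] with s hs
        have e : ⟪v s, y s - x₀⟫_ℝ = ⟪A (y s) - A x₀, y s - x₀⟫_ℝ + ⟪A x₀ + f s, y s - x₀⟫_ℝ := by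
          rw [← inner_add_left]; congr 1; simp only [hv]; abel
        have h1 := real_inner_le_norm (A x₀ + f s) (y s - x₀)
        have h2 : ‖A x₀ + f s‖ ≤ N + M :=
          (norm_add_le _ _).trans (add_le_add hx₀ (hM s (hsub hs)))
        have h3 := mul_le_mul_of_nonneg_right h2 (norm_nonneg (y s - x₀))
        linarith [hA (y s) x₀]) (t := h) ⟨hh.1, le_rfl⟩
    simp only [norm_zero, zero_add] at this
    refine this.trans (le_of_eq ?_)
    simp [hh.1]
    ring
  -- Compare `y` with its time translate by `h`, whose forcing differs by at most Lh; the interval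
  -- [0, T + 1] leaves room for the shift. Letting h → 0 bounds y' = A y + f.
  have quot : ∀ h ∈ Ioc (0 : ℝ) 1, ‖y (t + h) - y t‖ ≤ (2 * (N + M) + 2 * (L * T)) * h := by
    intro h hh
    have := norm_le_of_inner_le (v := fun s => v (s + h) - v s) (w := fun t => y (t + h) - y t)
      (r := fun _ => L * h) (w₀ := y h - x₀)
      (T := T) (Continuous.integrableOn_Icc (by fun_prop)) (fun t ht => by
        have e1 : ∫ s in (0 : ℝ)..t, (v (s + h) - v s) =
            (∫ s in (0 : ℝ)..(t + h), v s) - (∫ s in (0 : ℝ)..h, v s) -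
              ∫ s in (0 : ℝ)..t, v s := by
          rw [intervalIntegral.integral_sub (Continuous.intervalIntegrable (by fun_prop) _ _)
            (hvi _ _), intervalIntegral.integral_comp_add_right, zero_add,
            intervalIntegral.integral_interval_sub_left (hvi _ _) (hvi _ _)]
        rw [hy (t + h) ⟨by linarith [ht.1, hh.1], by linarith [ht.2, hh.2]⟩,
          hy t ⟨ht.1, by linarith [ht.2]⟩, hy h ⟨hh.1.le, by linarith [hh.2]⟩, e1]
        simp only [hv]
        abel)
      (integrableOn_const (by simp)) (fun _ => mul_nonneg L.2 hh.1.le) (by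
        refine ae_of_all _ fun s => ?_
        have e : ⟪v (s + h) - v s, y (s + h) - y s⟫_ℝ =
            ⟪A (y (s + h)) - A (y s), y (s + h) - y s⟫_ℝ +
              ⟪f (s + h) - f s, y (s + h) - y s⟫_ℝ := by
          rw [← inner_add_left]; congr 1; simp only [hv]; abel
        have h1 := real_inner_le_norm (f (s + h) - f s) (y (s + h) - y s)
        have h2 : ‖f (s + h) - f s‖ ≤ L * h := by
          have := hf.dist_le_mul (s + h) s
          rwa [dist_eq_norm, dist_eq_norm, add_sub_cancel_left, Real.norm_eq_abs,
            abs_of_pos hh.1] at this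
        have h3 := mul_le_mul_of_nonneg_right h2 (norm_nonneg (y (s + h) - y s))
        linarith [hA (y (s + h)) (y s)]) ht
    refine this.trans ?_
    have h1 := start h ⟨hh.1.le, hh.2⟩
    have h2 : ∫ _ in Icc 0 T, (L : ℝ) * h = L * h * T := by simp [hT, mul_comm]
    rw [h2]
    linarith
  have hd : HasDerivAt (fun t => x₀ + ∫ s in (0 : ℝ)..t, v s) (v t) t :=
    (hvc.integral_hasStrictDerivAt 0 t).hasDerivAt.const_add x₀
  have hlim := hd.tendsto_slope_zero_right.norm
  have hvb : ‖v t‖ ≤ 2 * (N + M) + 2 * (L * T) := by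
    refine le_of_tendsto hlim ?_
    filter_upwards [Ioc_mem_nhdsGT (zero_lt_one' ℝ)] with h hh
    have e1 := hy (t + h) ⟨by linarith [ht.1, hh.1], by linarith [ht.2, hh.2]⟩
    have e2 := hy t ⟨ht.1, by linarith [ht.2]⟩
    rw [← e1, ← e2, norm_smul, norm_inv, Real.norm_eq_abs, abs_of_pos hh.1, ← div_eq_inv_mul,
      div_le_iff₀ hh.1]
    exact quot h hh
  have e : A (y t) = v t - f t := by simp [hv]
  rw [e]
  exact (norm_sub_le _ _).trans (add_le_add hvb (hM t ⟨ht.1, by linarith [ht.2]⟩))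

/-- Needed because F(z(t)) is obtained only as a weak limit; the countable basis recovers it as a
limit of its partial expansions. -/
theorem aestronglyMeasurable_of_inner {α ι : Type*} [MeasurableSpace α] {μ : Measure α}
    [Countable ι] (b : HilbertBasis ι ℝ X) {g : α → X}
    (hg : ∀ h : X, AEStronglyMeasurable (fun a => ⟪h, g a⟫_ℝ) μ) : AEStronglyMeasurable g μ := by
  refine aestronglyMeasurable_of_tendsto_ae (atTop : Filter (Finset ι))
    (f := fun s a => ∑ i ∈ s, ⟪b i, g a⟫_ℝ • b i) (fun s => ?_)
    (ae_of_all _ fun a => ?_)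
  · refine Finset.aestronglyMeasurable_fun_sum _ fun i _ => (hg (b i)).smul_const _
  · have := b.hasSum_repr (g a)
    simp only [b.repr_apply_apply] at this
    exact this

end MDissipative

/-! ### Strong solutions by Yosida approximation. -/

section Existence

variable {X : Type*} [NormedAddCommGroup X] [InnerProductSpace ℝ X]

/-- Kato's theorem: for an m-dissipative operator, Lipschitz forcing and initial datum in the
domain, a strong solution exists. -/
theorem IsMDissipative.exists_isStrongSolution [CompleteSpace X] {ι : Type*} [Countable ι]
    (b : HilbertBasis ι ℝ X) {D : Set X} {F : X → X} (hF : IsMDissipative D F) {f : ℝ → X}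
    {L : NNReal} (hf : LipschitzWith L f) {T : ℝ} (hT : 0 ≤ T) {x₀ : X} (hx₀ : x₀ ∈ D) :
    ∃ y, IsStrongSolution D F f T x₀ y := by
  have hl : ∀ k : ℕ, (0 : ℝ) < 1 / ((k : ℝ) + 1) := fun k => Nat.one_div_pos_of_nat
  have hl0 : Tendsto (fun k : ℕ => 1 / ((k : ℝ) + 1)) atTop (𝓝 0) :=
    tendsto_one_div_add_atTop_nhds_zero_nat
  set lam : ℕ → ℝ := fun k => 1 / ((k : ℝ) + 1) with hlam
  choose J hJD hJ hJL hdis hJx using fun k => hF.exists_resolvent (hl k)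
  choose K hK using hJL
  have hT1 : 0 ≤ T + 1 := by linarith
  choose y hyc hy using fun k => exists_integral_eq_of_lipschitz (hK k) hf.continuous x₀ hT1
  obtain ⟨M, hM⟩ := (isCompact_Icc (a := (0 : ℝ)) (b := T + 1)).exists_bound_of_continuousOn
    hf.continuous.continuousOn
  set C : ℝ := 2 * (‖F x₀‖ + M) + 2 * (L * T) + M with hCdef
  have hC : ∀ k, ∀ t ∈ Icc 0 T, ‖F (J k (y k t))‖ ≤ C := fun k t ht =>
    norm_velocity_le (A := fun z => F (J k z)) (hK k).continuous (hdis k) hf (norm_nonneg _) hM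
      (hJx k x₀ hx₀) (hyc k) (hy k) ht
  have hC0 : 0 ≤ C := (norm_nonneg _).trans (hC 0 0 ⟨le_rfl, hT⟩)
  have hyT : ∀ k, ∀ t ∈ Icc 0 T, y k t = x₀ + ∫ s in (0 : ℝ)..t, (F (J k (y k s)) + f s) :=
    fun k t ht => hy k t ⟨ht.1, by linarith [ht.2]⟩
  have hac : ∀ k, Continuous fun s => F (J k (y k s)) := fun k =>
    (hK k).continuous.comp (hyc k)
  have hacf : ∀ k, Continuous fun s => F (J k (y k s)) + f s := fun k => (hac k).add hf.continuous
  have hest : ∀ k l, ∀ t ∈ Icc 0 T, ‖y k t - y l t‖ ^ 2 ≤ 4 * C ^ 2 * T * (lam k + lam l) := by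
    intro k l t ht
    set v : ℝ → X := fun s => F (J k (y k s)) - F (J l (y l s)) with hv
    have hvc : Continuous v := (hac k).sub (hac l)
    have hw : ∀ t ∈ Icc 0 T, y k t - y l t = 0 + ∫ s in (0 : ℝ)..t, v s := by
      intro t ht
      rw [hyT k t ht, hyT l t ht, add_sub_add_left_eq_sub, zero_add,
        ← intervalIntegral.integral_sub
          ((hacf k).intervalIntegrable _ _)
          ((hacf l).intervalIntegrable _ _)]
      simp only [hv, add_sub_add_right_eq_sub]
    have e := norm_sq_add_primitive_of_continuous hvc 0 t
    rw [← hw t ht] at e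
    rw [e, norm_zero]
    have hb : ∀ s ∈ Icc 0 T,
        ⟪v s, (0 : X) + ∫ r in (0 : ℝ)..s, v r⟫_ℝ ≤ 2 * C ^ 2 * (lam k + lam l) := by
      intro s hs
      rw [← hw s hs]
      -- From z = J z − lam F(J z): the resolvent difference pairs nonpositively with `v s`, leaving
      -- an error at most 2C · (lam k + lam l)C.
      have e1 : y k s - y l s = (J k (y k s) - J l (y l s)) -
          (lam k • F (J k (y k s)) - lam l • F (J l (y l s))) := by
        conv_lhs => rw [← hJ k (y k s), ← hJ l (y l s)]
        abel
      rw [e1, inner_sub_right]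
      have h1 := hF.dissipative _ (hJD k (y k s)) _ (hJD l (y l s))
      have h2 := abs_le.1 (abs_real_inner_le_norm (v s)
        (lam k • F (J k (y k s)) - lam l • F (J l (y l s))))
      have h3 : ‖v s‖ ≤ 2 * C := (norm_sub_le _ _).trans (by linarith [hC k s hs, hC l s hs])
      have h4 : ‖lam k • F (J k (y k s)) - lam l • F (J l (y l s))‖ ≤ (lam k + lam l) * C := by
        refine (norm_sub_le _ _).trans ?_
        rw [norm_smul, norm_smul, Real.norm_of_nonneg (hl k).le, Real.norm_of_nonneg (hl l).le,
          add_mul]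
        exact add_le_add (mul_le_mul_of_nonneg_left (hC k s hs) (hl k).le)
          (mul_le_mul_of_nonneg_left (hC l s hs) (hl l).le)
      have h5 := mul_le_mul h3 h4 (norm_nonneg _) (by linarith)
      have h6 : 2 * C * ((lam k + lam l) * C) = 2 * C ^ 2 * (lam k + lam l) := by ring
      linarith [h2.1]
    have hwc : Continuous fun s => (0 : X) + ∫ r in (0 : ℝ)..s, v r :=
      continuous_const.add (intervalIntegral.continuous_primitive
        (fun a b => hvc.intervalIntegrable a b) 0)
    have hI := intervalIntegral.integral_mono_on ht.1
      ((hvc.inner hwc).intervalIntegrable 0 t) (intervalIntegrable_const (μ := volume))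
      (fun s hs => hb s ⟨hs.1, hs.2.trans ht.2⟩)
    rw [intervalIntegral.integral_const, smul_eq_mul, sub_zero] at hI
    have hlk := hl k
    have hll := hl l
    have h7 : 0 ≤ 2 * C ^ 2 * (lam k + lam l) := by positivity
    have h8 := mul_le_mul_of_nonneg_right ht.2 h7
    linarith
  have hcauchy : ∀ t ∈ Icc 0 T, CauchySeq fun k => y k t := by
    intro t ht
    rw [Metric.cauchySeq_iff']
    intro ε hε
    have hpos : 0 < ε ^ 2 / (8 * C ^ 2 * T + 1) := by positivity
    obtain ⟨n, hn⟩ := (hl0.eventually (gt_mem_nhds hpos)).exists_forall_of_atTop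
    refine ⟨n, fun k hk => ?_⟩
    have h1 := hest k n t ht
    have h2 : lam k + lam n < 2 * (ε ^ 2 / (8 * C ^ 2 * T + 1)) := by
      linarith [hn k hk, hn n le_rfl]
    rw [dist_eq_norm]
    refine lt_of_pow_lt_pow_left₀ 2 hε.le (h1.trans_lt ?_)
    have h3 : 0 ≤ 4 * C ^ 2 * T := by positivity
    calc 4 * C ^ 2 * T * (lam k + lam n)
        ≤ 4 * C ^ 2 * T * (2 * (ε ^ 2 / (8 * C ^ 2 * T + 1))) := by gcongr
      _ = ε ^ 2 * (8 * C ^ 2 * T / (8 * C ^ 2 * T + 1)) := by ring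
      _ < ε ^ 2 * 1 := by
          gcongr
          rw [div_lt_one (by positivity)]
          linarith
      _ = ε ^ 2 := mul_one _
  have hlim : ∀ t : ℝ, ∃ z, t ∈ Icc 0 T → Tendsto (fun k => y k t) atTop (𝓝 z) := by
    intro t
    by_cases ht : t ∈ Icc 0 T
    · obtain ⟨z, hz⟩ := cauchySeq_tendsto_of_complete (hcauchy t ht)
      exact ⟨z, fun _ => hz⟩
    · exact ⟨0, fun h => absurd h ht⟩
  choose z hz using hlim
  -- J_k y_k − y_k = lam_k F(J_k y_k) → 0 by the uniform bound, so J_k y_k → z too and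
  -- demiclosedness applies.
  have hdemi : ∀ t ∈ Icc 0 T, z t ∈ D ∧
      ∀ h : X, Tendsto (fun k => ⟪h, F (J k (y k t))⟫_ℝ) atTop (𝓝 ⟪h, F (z t)⟫_ℝ) := by
    intro t ht
    refine hF.demiclosed (C := C) (fun k => hJD k _) ?_ fun k => hC k t ht
    have h1 : ∀ k, J k (y k t) = y k t + lam k • F (J k (y k t)) := fun k =>
      sub_eq_iff_eq_add.1 (hJ k (y k t))
    have h2 : Tendsto (fun k => lam k • F (J k (y k t))) atTop (𝓝 0) := by
      refine squeeze_zero_norm (a := fun k => lam k * C) (fun k => ?_) ?_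
      · rw [norm_smul, Real.norm_of_nonneg (hl k).le]
        exact mul_le_mul_of_nonneg_left (hC k t ht) (hl k).le
      · simpa using hl0.mul_const C
    have h3 := (hz t ht).add h2
    rw [add_zero] at h3
    exact h3.congr fun k => (h1 k).symm
  have hinner : ∀ h : X, AEStronglyMeasurable (fun t => ⟪h, F (z t)⟫_ℝ)
      (volume.restrict (Icc 0 T)) := fun h =>
    aestronglyMeasurable_of_tendsto_ae atTop
      (fun k => (continuous_const.inner (hac k)).aestronglyMeasurable)
      ((ae_restrict_mem measurableSet_Icc).mono fun t ht => (hdemi t ht).2 h)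
  have hFz : ∀ t ∈ Icc 0 T, ‖F (z t)‖ ≤ C := by
    intro t ht
    have h1 : ‖F (z t)‖ ^ 2 ≤ C * ‖F (z t)‖ := by
      rw [← real_inner_self_eq_norm_sq]
      refine le_of_tendsto ((hdemi t ht).2 (F (z t))) (Eventually.of_forall fun k => ?_)
      refine (real_inner_le_norm _ _).trans ?_
      rw [mul_comm]
      exact mul_le_mul_of_nonneg_right (hC k t ht) (norm_nonneg _)
    by_contra! hlt
    nlinarith [norm_nonneg (F (z t))]
  have hFi : IntegrableOn (fun t => F (z t)) (Icc 0 T) :=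
    Integrable.mono' (g := fun _ => C) (integrableOn_const (by simp))
      (aestronglyMeasurable_of_inner b hinner)
      ((ae_restrict_mem measurableSet_Icc).mono hFz)
  refine ⟨z, (ae_restrict_mem measurableSet_Icc).mono fun t ht => (hdemi t ht).1,
    hFi.add hf.continuous.integrableOn_Icc, fun t ht => ?_⟩
  have hsub : uIcc 0 t ⊆ Icc 0 T := by rw [uIcc_of_le ht.1]; exact Icc_subset_Icc_right ht.2
  have hii : IntervalIntegrable (fun s => F (z s) + f s) volume 0 t :=
    ((hFi.add hf.continuous.integrableOn_Icc).mono_set hsub).intervalIntegrable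
  -- The velocities converge only weakly, so the integrated equation is passed to the limit against
  -- each fixed `h`, by dominated convergence.
  refine ext_inner_left ℝ fun h => ?_
  have t1 : Tendsto (fun k => ⟪h, y k t⟫_ℝ) atTop (𝓝 ⟪h, z t⟫_ℝ) :=
    tendsto_const_nhds.inner (hz t ht)
  have e1 : ∀ k, ⟪h, y k t⟫_ℝ =
      ⟪h, x₀⟫_ℝ + ∫ s in (0 : ℝ)..t, ⟪h, F (J k (y k s)) + f s⟫_ℝ := by
    intro k
    rw [hyT k t ht, inner_add_right]
    congr 1
    exact ((innerSL ℝ h).intervalIntegral_comp_comm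
      ((hacf k).intervalIntegrable 0 t)).symm
  have e2 : ⟪h, x₀ + ∫ s in (0 : ℝ)..t, (F (z s) + f s)⟫_ℝ =
      ⟪h, x₀⟫_ℝ + ∫ s in (0 : ℝ)..t, ⟪h, F (z s) + f s⟫_ℝ := by
    rw [inner_add_right]
    congr 1
    exact ((innerSL ℝ h).intervalIntegral_comp_comm hii).symm
  rw [e2]
  refine tendsto_nhds_unique t1 ?_
  simp only [e1]
  refine tendsto_const_nhds.add ?_
  refine intervalIntegral.tendsto_integral_filter_of_dominated_convergence
    (fun _ => ‖h‖ * (C + M)) (Eventually.of_forall fun k => ?_)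
    (Eventually.of_forall fun k => ae_of_all _ fun s hs => ?_) intervalIntegrable_const
    (ae_of_all _ fun s hs => ?_)
  · exact (continuous_const.inner (hacf k)).aestronglyMeasurable
  · have hs' : s ∈ Icc 0 T := hsub (uIoc_subset_uIcc hs)
    refine (norm_inner_le_norm _ _).trans (mul_le_mul_of_nonneg_left ?_ (norm_nonneg _))
    exact (norm_add_le _ _).trans
      (add_le_add (hC k s hs') (hM s ⟨hs'.1, by linarith [hs'.2]⟩))
  · have hs' : s ∈ Icc 0 T := hsub (uIoc_subset_uIcc hs)
    simp only [inner_add_right]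
    exact ((hdemi s hs').2 h).add_const _

end Existence

/-! ### Continuous dissipative maps in finite dimension. -/

section FiniteDimensional

variable {X : Type*} [NormedAddCommGroup X] [InnerProductSpace ℝ X]

open scoped Convolution

theorem norm_sub_le_norm_sub_smul_of_dissipative {G : X → X}
    (hG : ∀ x y, ⟪G x - G y, x - y⟫_ℝ ≤ 0) {lam : ℝ} (hl : 0 ≤ lam) (x y : X) :
    ‖x - y‖ ≤ ‖(x - lam • G x) - (y - lam • G y)‖ := by
  have h1 : ⟪(x - lam • G x) - (y - lam • G y), x - y⟫_ℝ =
      ‖x - y‖ ^ 2 - lam * ⟪G x - G y, x - y⟫_ℝ := by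
    have : (x - lam • G x) - (y - lam • G y) = (x - y) - lam • (G x - G y) := by
      rw [smul_sub]; abel
    rw [this, inner_sub_left, real_inner_self_eq_norm_sq, inner_smul_left]
    simp
  have h2 := real_inner_le_norm ((x - lam • G x) - (y - lam • G y)) (x - y)
  have h3 := mul_nonneg hl (neg_nonneg.2 (hG x y))
  by_contra! hlt
  nlinarith [norm_nonneg ((x - lam • G x) - (y - lam • G y)), norm_nonneg (x - y)]

variable [FiniteDimensional ℝ X]

/-- The range of I − lam G is clopen. Expansiveness makes the map proper, hence closed; it also
makes each derivative injective, hence surjective in finite dimension, so the map is open. -/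
theorem surjective_sub_smul_of_contDiff {G : X → X} (hGc : ContDiff ℝ 1 G)
    (hG : ∀ x y, ⟪G x - G y, x - y⟫_ℝ ≤ 0) {lam : ℝ} (hl : 0 ≤ lam) :
    Function.Surjective fun x => x - lam • G x := by
  set Φ : X → X := fun x => x - lam • G x with hΦ
  have hΦc : ContDiff ℝ 1 Φ := contDiff_id.sub (contDiff_const.smul hGc)
  have hexp : ∀ x y, ‖x - y‖ ≤ ‖Φ x - Φ y‖ := norm_sub_le_norm_sub_smul_of_dissipative hG hl
  have hanti : AntilipschitzWith 1 Φ := AntilipschitzWith.of_le_mul_dist fun x y => by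
    simpa [dist_eq_norm] using hexp x y
  have hclosed : IsClosed (range Φ) := by
    have hp : IsProperMap Φ := isProperMap_iff_tendsto_cocompact.2 ⟨hΦc.continuous, by
      rw [← Metric.cobounded_eq_cocompact]
      exact hanti.tendsto_cobounded⟩
    exact hp.isClosedMap.isClosed_range
  have hopen : IsOpenMap Φ := by
    rw [isOpenMap_iff_nhds_le]
    intro x
    have hd := hΦc.contDiffAt.hasStrictFDerivAt (x := x) one_ne_zero
    refine (hd.map_nhds_eq_of_surj ?_).ge
    rw [LinearMap.range_eq_top]
    refine LinearMap.injective_iff_surjective.1 ?_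
    refine (injective_iff_map_eq_zero _).2 fun v hv => ?_
    have hline : HasDerivAt (fun t : ℝ => Φ (x + t • v)) (fderiv ℝ Φ x v) 0 :=
      hd.hasFDerivAt.hasLineDerivAt v
    have h1 := hline.tendsto_slope_zero_right.norm
    have hv' : fderiv ℝ Φ x v = 0 := hv
    rw [hv', norm_zero] at h1
    have h2 : ‖v‖ ≤ 0 := by
      refine ge_of_tendsto h1 ?_
      filter_upwards [self_mem_nhdsWithin] with t ht
      have ht : 0 < t := ht
      have := hexp (x + t • v) x
      rw [add_sub_cancel_left, norm_smul, Real.norm_of_nonneg ht.le] at this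
      rw [norm_smul, norm_inv, Real.norm_of_nonneg ht.le, ← div_eq_inv_mul, le_div_iff₀ ht]
      simpa [mul_comm] using this
    exact norm_eq_zero.1 (le_antisymm h2 (norm_nonneg _))
  exact range_eq_univ.1 (IsClopen.eq_univ ⟨hclosed, hopen.isOpen_range⟩ (range_nonempty Φ))

/-- A continuous dissipative operator on a finite-dimensional space is m-dissipative. -/
theorem isMDissipative_univ_of_continuous {G : X → X} (hGc : Continuous G)
    (hG : ∀ x y, ⟪G x - G y, x - y⟫_ℝ ≤ 0) : IsMDissipative univ G := by
  refine ⟨fun x _ y _ => hG x y, fun lam hl z => ?_⟩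
  let _ : MeasurableSpace X := borel X
  have : BorelSpace X := ⟨rfl⟩
  let φ : ℕ → ContDiffBump (0 : X) := fun k =>
    ⟨1 / ((k : ℝ) + 1) / 2, 1 / ((k : ℝ) + 1), by positivity, half_lt_self (by positivity)⟩
  have hφ : Tendsto (fun k => (φ k).rOut) atTop (𝓝 0) := tendsto_one_div_add_atTop_nhds_zero_nat
  let Gs : ℕ → X → X := fun k => (φ k).normed volume ⋆[ContinuousLinearMap.lsmul ℝ ℝ, volume] G
  have hGs : ∀ k, ContDiff ℝ 1 (Gs k) := fun k =>
    (φ k).hasCompactSupport_normed.contDiff_convolution_left _ (φ k).contDiff_normed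
      hGc.locallyIntegrable
  have hint : ∀ k x, Integrable (fun t => (φ k).normed volume t • G (x - t)) := fun k x =>
    Continuous.integrable_of_hasCompactSupport
      ((φ k).continuous_normed.smul (hGc.comp (continuous_const.sub continuous_id)))
      ((φ k).hasCompactSupport_normed.smul_right)
  -- A mollification is a nonnegatively weighted average of translates of `G`, so it remains
  -- dissipative.
  have hdis : ∀ k x y, ⟪Gs k x - Gs k y, x - y⟫_ℝ ≤ 0 := by
    intro k x y
    have e : Gs k x - Gs k y =
        ∫ t, (φ k).normed volume t • (G (x - t) - G (y - t)) := by
      simp only [smul_sub]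
      rw [integral_sub (hint k x) (hint k y)]
      rfl
    have hi : Integrable fun t => (φ k).normed volume t • (G (x - t) - G (y - t)) := by
      simp only [smul_sub]
      exact (hint k x).sub (hint k y)
    rw [e, real_inner_comm, ← integral_inner hi]
    refine integral_nonpos fun t => ?_
    simp only [Pi.zero_apply]
    rw [inner_smul_right, real_inner_comm]
    have := hG (x - t) (y - t)
    rw [sub_sub_sub_cancel_right] at this
    exact mul_nonpos_of_nonneg_of_nonpos ((φ k).nonneg_normed t) this
  choose x hx using fun k => surjective_sub_smul_of_contDiff (hGs k) (hdis k) hl.le z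
  -- Expansiveness against the point 0 bounds the solutions of the mollified equations, so that a
  -- subsequence converges.
  have hx0 : ∀ k, ‖x k‖ ≤ ‖z‖ + lam * ‖Gs k 0‖ := by
    intro k
    have := norm_sub_le_norm_sub_smul_of_dissipative (hdis k) hl.le (x k) 0
    have hxk : x k - lam • Gs k (x k) = z := hx k
    rw [hxk, sub_zero, zero_sub, sub_neg_eq_add] at this
    refine this.trans ((norm_add_le _ _).trans ?_)
    rw [norm_smul, Real.norm_of_nonneg hl.le]
  have hG0 : Tendsto (fun k => Gs k 0) atTop (𝓝 (G 0)) :=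
    ContDiffBump.convolution_tendsto_right_of_continuous hφ hGc 0
  obtain ⟨R, hR⟩ := hG0.norm.bddAbove_range
  have hxR : ∀ k, x k ∈ Metric.closedBall (0 : X) (‖z‖ + lam * R) := fun k => by
    rw [mem_closedBall_zero_iff]
    have := mul_le_mul_of_nonneg_left (hR ⟨k, rfl⟩) hl.le
    linarith [hx0 k]
  obtain ⟨w, -, ψ, hψ, hw⟩ := (isCompact_closedBall (0 : X) (‖z‖ + lam * R)).tendsto_subseq hxR
  have hGw : Tendsto (fun k => Gs (ψ k) (x (ψ k))) atTop (𝓝 (G w)) :=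
    ContDiffBump.convolution_tendsto_right (φ := fun k => φ (ψ k)) (g := fun _ => G)
      (hφ.comp hψ.tendsto_atTop) (Eventually.of_forall fun _ => hGc.aestronglyMeasurable)
      ((hGc.tendsto w).comp tendsto_snd) hw
  refine ⟨w, mem_univ _, ?_⟩
  have := hw.sub (hGw.const_smul lam)
  refine tendsto_nhds_unique this ?_
  exact tendsto_const_nhds.congr fun k => (hx (ψ k)).symm

end FiniteDimensional

/-! ### Integrable reparametrization and approximation of forcings. -/

/-- A time change slow enough to integrate a given nonnegative measurable function: `σ` is an
absolutely continuous parametrization of `[0, 1]` by `[0, T]` with `φ ∘ σ` integrable. -/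
theorem exists_timeChange_integrableOn_comp {φ : ℝ → ℝ} (hφ : Measurable φ) (hφ0 : ∀ s, 0 ≤ φ s)
    {T : ℝ} (hT : 0 < T) :
    ∃ σ v : ℝ → ℝ, Continuous σ ∧ IntegrableOn v (Icc 0 T) ∧
      (∀ t ∈ Icc 0 T, σ t = ∫ s in (0 : ℝ)..t, v s) ∧ σ T = 1 ∧
      IntegrableOn (fun t => φ (σ t)) (Icc 0 T) := by
  -- The inverse τ of σ is built with density c/(1 + ψ), `c` being chosen so that τ(1) = T. Cutting
  -- φ off outside (0, 1) makes τ affine there, hence a bijection of ℝ.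
  set ψ : ℝ → ℝ := (Ioo 0 1).indicator φ with hψ
  have hψm : Measurable ψ := hφ.indicator measurableSet_Ioo
  have hψ0 : ∀ s, 0 ≤ ψ s := fun s => indicator_nonneg (fun s _ => hφ0 s) s
  set ρ : ℝ → ℝ := fun s => (1 + ψ s)⁻¹ with hρ
  have hρm : Measurable ρ := (measurable_const.add hψm).inv
  have hρ0 : ∀ s, 0 < ρ s := fun s => inv_pos.2 (by linarith [hψ0 s])
  have hρ1 : ∀ s, ρ s ≤ 1 := fun s => inv_le_one_of_one_le₀ (by linarith [hψ0 s])
  have hρi : ∀ a b, IntervalIntegrable ρ volume a b := fun a b =>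
    (intervalIntegrable_const (c := (1 : ℝ))).mono_fun hρm.aestronglyMeasurable
      (ae_of_all _ fun s => by simpa [abs_of_pos (hρ0 s)] using hρ1 s)
  have hI : 0 < ∫ s in (0 : ℝ)..1, ρ s :=
    intervalIntegral.intervalIntegral_pos_of_pos_on (hρi 0 1) (fun s _ => hρ0 s) one_pos
  set c : ℝ := T / ∫ s in (0 : ℝ)..1, ρ s with hc
  have hc0 : 0 < c := div_pos hT hI
  set d : ℝ → ℝ := fun s => c * ρ s with hd
  have hdm : Measurable d := hρm.const_mul c
  have hd0 : ∀ s, 0 < d s := fun s => mul_pos hc0 (hρ0 s)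
  have hdi : ∀ a b, IntervalIntegrable d volume a b := fun a b => (hρi a b).const_mul c
  set τ : ℝ → ℝ := fun s => ∫ r in (0 : ℝ)..s, d r with hτ
  have hτsub : ∀ a b, τ b - τ a = ∫ r in a..b, d r := fun a b =>
    intervalIntegral.integral_interval_sub_left (hdi _ _) (hdi _ _)
  have hmono : StrictMono τ := fun a b hab => by
    have := intervalIntegral.intervalIntegral_pos_of_pos_on (hdi a b) (fun s _ => hd0 s) hab
    linarith [hτsub a b]
  have hτc : Continuous τ := intervalIntegral.continuous_primitive hdi 0
  have hout : ∀ s, s ∉ Ioo (0 : ℝ) 1 → d s = c := fun s hs => by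
    simp [hd, hρ, hψ, indicator_of_notMem hs]
  have hτ1 : τ 1 = T := by
    simp only [hτ, hd]
    rw [intervalIntegral.integral_const_mul, hc, div_mul_cancel₀ _ hI.ne']
  have hτ0 : τ 0 = 0 := intervalIntegral.integral_same
  have hright : ∀ s, 1 ≤ s → τ s = c * s + (T - c) := fun s hs => by
    have h1 := hτsub 1 s
    have h2 : ∫ r in (1 : ℝ)..s, d r = ∫ r in (1 : ℝ)..s, c :=
      intervalIntegral.integral_congr fun r hr => by
        rw [uIcc_of_le hs] at hr
        exact hout r fun h => by linarith [h.2, hr.1]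
    rw [h2, hτ1, intervalIntegral.integral_const, smul_eq_mul] at h1
    linarith
  have hleft : ∀ s, s ≤ 0 → τ s = c * s := fun s hs => by
    have h1 := hτsub s 0
    have h2 : ∫ r in s..(0 : ℝ), d r = ∫ r in s..(0 : ℝ), c :=
      intervalIntegral.integral_congr fun r hr => by
        rw [uIcc_of_le hs] at hr
        exact hout r fun h => by linarith [h.1, hr.2]
    rw [h2, hτ0, intervalIntegral.integral_const, smul_eq_mul] at h1
    linarith
  have hsurj : Function.Surjective τ := by
    refine hτc.surjective ?_ ?_
    · refine Tendsto.congr' ((eventually_ge_atTop 1).mono fun s hs => (hright s hs).symm) ?_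
      exact tendsto_atTop_add_const_right _ _ (tendsto_id.const_mul_atTop hc0)
    · refine Tendsto.congr' ((eventually_le_atBot 0).mono fun s hs => (hleft s hs).symm) ?_
      exact tendsto_id.const_mul_atBot hc0
  set Θ : ℝ ≃o ℝ := hmono.orderIsoOfSurjective τ hsurj with hΘ
  have hΘτ : ∀ s, Θ s = τ s := fun s => rfl
  have hστ : ∀ s, Θ.symm (τ s) = s := fun s => Θ.symm_apply_apply s
  have hτσ : ∀ t, τ (Θ.symm t) = t := fun t => Θ.apply_symm_apply t
  have hpre : ∀ a b, τ ⁻¹' Ioo a b = Ioo (Θ.symm a) (Θ.symm b) := fun a b => Θ.preimage_Ioo a b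
  -- As τ is only absolutely continuous, the substitution is carried by measures: τ pushes its own
  -- density measure to Lebesgue measure, as checked on rational intervals.
  set ν : Measure ℝ := volume.withDensity fun s => ((d s).toNNReal : ENNReal) with hν
  have hmp : MeasurePreserving τ ν volume := by
    refine ⟨hτc.measurable, Eq.symm ?_⟩
    refine Real.measure_ext_Ioo_rat fun a b => ?_
    rw [Measure.map_apply hτc.measurable measurableSet_Ioo, hpre, hν,
      withDensity_apply _ measurableSet_Ioo, Real.volume_Ioo]
    rcases le_total (b : ℝ) a with h | h
    · have : Θ.symm (b : ℝ) ≤ Θ.symm a := Θ.symm.monotone h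
      rw [Ioo_eq_empty_of_le this, ENNReal.ofReal_of_nonpos (by linarith)]
      simp
    · have h' : Θ.symm (a : ℝ) ≤ Θ.symm b := Θ.symm.monotone h
      have h1 := hτsub (Θ.symm a) (Θ.symm b)
      rw [hτσ, hτσ, intervalIntegral.integral_of_le h', integral_Ioc_eq_integral_Ioo] at h1
      rw [h1, ofReal_integral_eq_lintegral_ofReal
        (((hdi _ _).1).mono_set Ioo_subset_Ioc_self) (ae_of_all _ fun s => (hd0 s).le)]
      rfl
  have hemb : MeasurableEmbedding τ := Θ.toHomeomorph.measurableEmbedding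
  set v : ℝ → ℝ := fun t => (d (Θ.symm t))⁻¹ with hv
  have hvτ : ∀ s, v (τ s) = (d s)⁻¹ := fun s => by simp only [hv, hστ]
  have hdmn : Measurable fun s => (d s).toNNReal := hdm.real_toNNReal
  have hone : ∀ s, (d s).toNNReal • (d s)⁻¹ = (1 : ℝ) := fun s => by
    rw [NNReal.smul_def, Real.coe_toNNReal _ (hd0 s).le, smul_eq_mul, mul_inv_cancel₀ (hd0 s).ne']
  have hpreIoc : ∀ t, τ ⁻¹' Ioc 0 t = Ioc 0 (Θ.symm t) := fun t => by
    have := Θ.preimage_Ioc 0 t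
    rwa [show Θ.symm 0 = 0 by rw [← hτ0, hστ, hτ0]] at this
  have hvi : IntegrableOn v (Icc 0 T) := by
    rw [integrableOn_Icc_iff_integrableOn_Ioc, ← hmp.integrableOn_comp_preimage hemb, hpreIoc,
      IntegrableOn, hν, restrict_withDensity measurableSet_Ioc,
      integrable_withDensity_iff_integrable_smul hdmn]
    simp only [Function.comp_apply, hvτ, hone]
    exact integrableOn_const (by simp)
  have hT1 : Θ.symm T = 1 := by rw [← hτ1, hστ]
  have h00 : Θ.symm 0 = 0 := by conv_lhs => rw [← hτ0, hστ]
  refine ⟨Θ.symm, v, Θ.symm.continuous, hvi, fun t ht => ?_, hT1, ?_⟩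
  · rw [intervalIntegral.integral_of_le ht.1, ← hmp.setIntegral_preimage_emb hemb, hpreIoc, hν,
      setIntegral_withDensity_eq_setIntegral_smul hdmn _ measurableSet_Ioc]
    simp only [hvτ, hone]
    have : 0 ≤ Θ.symm t := by rw [← h00]; exact Θ.symm.monotone ht.1
    simp [this]
  · rw [integrableOn_Icc_iff_integrableOn_Ioo]
    have hvi' : IntegrableOn (fun t => c * v t) (Ioo 0 T) :=
      (hvi.mono_set Ioo_subset_Icc_self).const_mul c
    -- On (0, T) one has c σ' = 1 + φ∘σ, so φ∘σ is dominated by the integrable c σ'.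
    refine Integrable.mono' hvi' (hφ.comp Θ.symm.continuous.measurable).aestronglyMeasurable ?_
    filter_upwards [ae_restrict_mem measurableSet_Ioo] with t ht
    have hm : Θ.symm t ∈ Ioo (0 : ℝ) 1 :=
      ⟨by rw [← h00]; exact Θ.symm.strictMono ht.1, by rw [← hT1]; exact Θ.symm.strictMono ht.2⟩
    rw [Real.norm_of_nonneg (hφ0 _)]
    simp only [hv, hd, hρ, mul_inv, inv_inv]
    rw [← mul_assoc, mul_inv_cancel₀ hc0.ne', one_mul, hψ, indicator_of_mem hm]
    linarith

/-- Integrable functions are approximated in `L¹` by the images of Lipschitz functions under a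
bounded operator with dense range. -/
theorem exists_lipschitzWith_integral_norm_sub_le {E H : Type*} [NormedAddCommGroup E]
    [NormedSpace ℝ E] [NormedAddCommGroup H] [NormedSpace ℝ H] (B : E →L[ℝ] H)
    (hB : DenseRange B) {T : ℝ} (hT : 0 < T) {g : ℝ → H} (hg : IntegrableOn g (Icc 0 T))
    {η : ℝ} (hη : 0 < η) :
    ∃ (u : ℝ → E) (L : NNReal), LipschitzWith L u ∧ ∫ t in Icc 0 T, ‖g t - B (u t)‖ ≤ η := by
  obtain ⟨g', -, hgg', hg'c, hg'i⟩ := hg.exists_hasCompactSupport_integral_sub_le (half_pos hη)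
  -- A uniform error 2κ over [0, T] contributes exactly η/2.
  set κ : ℝ := η / (2 * T) / 2 with hκ
  have hκ0 : 0 < κ := by positivity
  let h : C(unitInterval, H) := ⟨fun x => g' (T * x), by fun_prop⟩
  obtain ⟨n, hn⟩ := ((Metric.tendsto_nhds.1 (bernsteinApproximation_uniform h)) κ hκ0).exists
  have hchoice : ∀ k : Fin (n + 1), ∃ a : E, dist (h (bernstein.z k)) (B a) < κ := fun k =>
    hB.exists_dist_lt _ hκ0
  choose a ha using hchoice
  -- A Bernstein polynomial whose coefficients are replaced by approximate preimages under `B`.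
  -- Bernstein weights are nonnegative with sum 1, so this adds at most κ, and polynomials are
  -- Lipschitz on [0, 1].
  let p : ℝ → E := fun x =>
    ∑ k : Fin (n + 1), ((n.choose k : ℝ) * x ^ (k : ℕ) * (1 - x) ^ (n - k)) • a k
  have hpc : ContDiff ℝ 1 p := by
    refine ContDiff.sum fun k _ => ContDiff.smul ?_ contDiff_const
    fun_prop
  obtain ⟨K, hK⟩ := hpc.contDiffOn.exists_lipschitzOnWith (s := Icc 0 1) one_ne_zero
    (convex_Icc 0 1) isCompact_Icc
  have hpx : ∀ x : unitInterval, ‖h x - B (p x)‖ ≤ 2 * κ := by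
    intro x
    have e1 : ‖h x - bernsteinApproximation n h x‖ ≤ κ := by
      rw [← dist_eq_norm, dist_comm]
      exact (ContinuousMap.dist_apply_le_dist x).trans hn.le
    have e2 : bernsteinApproximation n h x - B (p x) =
        ∑ k : Fin (n + 1), bernstein n k x • (h (bernstein.z k) - B (a k)) := by
      simp only [p, map_sum, map_smul, bernsteinApproximation.apply, smul_sub,
        Finset.sum_sub_distrib, bernstein_apply]
    have e3 : ‖bernsteinApproximation n h x - B (p x)‖ ≤ κ := by
      rw [e2]
      refine (norm_sum_le _ _).trans ?_
      calc ∑ k : Fin (n + 1), ‖bernstein n k x • (h (bernstein.z k) - B (a k))‖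
          ≤ ∑ k : Fin (n + 1), bernstein n k x * κ := by
            refine Finset.sum_le_sum fun k _ => ?_
            rw [norm_smul, Real.norm_of_nonneg bernstein_nonneg, ← dist_eq_norm]
            exact mul_le_mul_of_nonneg_left (ha k).le bernstein_nonneg
        _ = κ := by rw [← Finset.sum_mul, bernstein.probability, one_mul]
    have e4 : h x - B (p x) =
        (h x - bernsteinApproximation n h x) + (bernsteinApproximation n h x - B (p x)) := by abel
    rw [e4]
    exact (norm_add_le _ _).trans (by linarith)
  let q : ℝ → ℝ := fun t => projIcc (0 : ℝ) 1 zero_le_one (t / T)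
  have hq : LipschitzWith (⟨T⁻¹, by positivity⟩ : NNReal) q := by
    refine LipschitzWith.of_dist_le_mul fun s t => ?_
    refine ((LipschitzWith.projIcc zero_le_one).dist_le_mul (s / T) (t / T)).trans (le_of_eq ?_)
    rw [NNReal.coe_one, one_mul, Real.dist_eq, Real.dist_eq, ← sub_div, abs_div, abs_of_pos hT]
    change _ = T⁻¹ * _
    rw [div_eq_inv_mul]
  have hu : LipschitzWith (K * ⟨T⁻¹, by positivity⟩) fun t => p (q t) := by
    rw [← lipschitzOnWith_univ]
    exact hK.comp hq.lipschitzOnWith fun t _ => (projIcc (0 : ℝ) 1 zero_le_one (t / T)).2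
  refine ⟨fun t => p (q t), _, hu, ?_⟩
  have hBu : Continuous fun t => B (p (q t)) := B.continuous.comp hu.continuous
  have hi1 : IntegrableOn (fun t => ‖g t - g' t‖) (Icc 0 T) := (hg.sub hg'i).norm
  have hi0 : IntegrableOn (fun t => ‖g t - B (p (q t))‖) (Icc 0 T) :=
    (hg.sub hBu.integrableOn_Icc).norm
  have hi2 : IntegrableOn (fun _ : ℝ => 2 * κ) (Icc 0 T) := integrableOn_const (by simp)
  calc ∫ t in Icc 0 T, ‖g t - B (p (q t))‖
      ≤ ∫ t in Icc 0 T, (‖g t - g' t‖ + 2 * κ) := by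
        refine setIntegral_mono_on hi0 (hi1.add hi2) measurableSet_Icc fun t ht => ?_
        have hx : t / T ∈ Icc (0 : ℝ) 1 :=
          ⟨div_nonneg ht.1 hT.le, (div_le_one hT).2 ht.2⟩
        have e1 := hpx ⟨t / T, hx⟩
        have e2 : h ⟨t / T, hx⟩ = g' t := by
          simp only [h, ContinuousMap.coe_mk]
          rw [mul_div_cancel₀ _ hT.ne']
        have e3 : q t = t / T := by simp only [q]; rw [projIcc_of_mem _ hx]
        rw [e2] at e1
        rw [e3]
        refine (norm_sub_le_norm_sub_add_norm_sub _ (g' t) _).trans ?_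
        simpa using e1
    _ = (∫ t in Icc 0 T, ‖g t - g' t‖) + ∫ t in Icc 0 T, 2 * κ := integral_add hi1 hi2
    _ ≤ η / 2 + η / 2 := by
        refine add_le_add hgg' (le_of_eq ?_)
        simp [hT.le, hκ]
        field_simp
    _ = η := by ring

/-! ### Continuous dependence, uniqueness and generalized solutions. -/

section Comparison

variable {X : Type*} [NormedAddCommGroup X] [InnerProductSpace ℝ X] {D : Set X} {F : X → X}

theorem IsStrongSolution.congr {f g : ℝ → X} {T : ℝ} {x₀ : X} {y : ℝ → X}
    (h : IsStrongSolution D F f T x₀ y) (hfg : f =ᵐ[volume.restrict (Icc 0 T)] g) :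
    IsStrongSolution D F g T x₀ y := by
  have hae : (fun t => F (y t) + f t) =ᵐ[volume.restrict (Icc 0 T)] fun t => F (y t) + g t :=
    hfg.mono fun t ht => by simp only [ht]
  refine ⟨h.ae_mem, h.integrableOn.congr hae, fun t ht => ?_⟩
  rw [h.eq_integral t ht, intervalIntegral.integral_of_le ht.1,
    intervalIntegral.integral_of_le ht.1]
  congr 1
  exact integral_congr_ae (ae_restrict_of_ae_restrict_of_subset
    (Ioc_subset_Icc_self.trans (Icc_subset_Icc_right ht.2)) hae)

theorem IsStrongSolution.apply_zero {f : ℝ → X} {T : ℝ} (hT : 0 ≤ T) {x₀ : X} {y : ℝ → X}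
    (h : IsStrongSolution D F f T x₀ y) : y 0 = x₀ := by
  simpa using h.eq_integral 0 ⟨le_rfl, hT⟩

/-- In the energy estimate for y − z dissipativity discards the F-terms, leaving only the difference
of forcings. -/
theorem IsStrongSolution.norm_sub_le [CompleteSpace X]
    (hF : ∀ x ∈ D, ∀ y ∈ D, ⟪F x - F y, x - y⟫_ℝ ≤ 0) {f g : ℝ → X} {T : ℝ} {x₀ z₀ : X}
    {y z : ℝ → X} (hy : IsStrongSolution D F f T x₀ y) (hz : IsStrongSolution D F g T z₀ z)
    (hf : IntegrableOn f (Icc 0 T)) (hg : IntegrableOn g (Icc 0 T)) {t : ℝ} (ht : t ∈ Icc 0 T) :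
    ‖y t - z t‖ ≤ ‖x₀ - z₀‖ + 2 * ∫ s in Icc 0 T, ‖f s - g s‖ := by
  refine norm_le_of_inner_le (w := fun t => y t - z t)
    (v := fun s => (F (y s) + f s) - (F (z s) + g s))
    (hy.integrableOn.sub hz.integrableOn) (fun t ht => ?_) (hf.sub hg).norm
    (fun s => norm_nonneg _) ?_ ht
  · have hsub : uIcc 0 t ⊆ Icc 0 T := by
      rw [uIcc_of_le ht.1]; exact Icc_subset_Icc_right ht.2
    rw [hy.eq_integral t ht, hz.eq_integral t ht, intervalIntegral.integral_sub
      (hy.integrableOn.mono_set hsub).intervalIntegrable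
      (hz.integrableOn.mono_set hsub).intervalIntegrable]
    abel
  · filter_upwards [hy.ae_mem, hz.ae_mem] with s h1 h2
    have e : ⟪(F (y s) + f s) - (F (z s) + g s), y s - z s⟫_ℝ =
        ⟪F (y s) - F (z s), y s - z s⟫_ℝ + ⟪f s - g s, y s - z s⟫_ℝ := by
      rw [← inner_add_left]; congr 1; abel
    rw [e]
    have h3 := real_inner_le_norm (f s - g s) (y s - z s)
    simp only [Pi.sub_apply]
    linarith [hF _ h1 _ h2]

theorem IsStrongSolution.isGeneralizedSolution {f : ℝ → X} {T : ℝ} (hT : 0 ≤ T) {x₀ : X}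
    {y : ℝ → X} (h : IsStrongSolution D F f T x₀ y) (hf : IntegrableOn f (Icc 0 T)) :
    IsGeneralizedSolution D F f T x₀ y where
  integrableOn := hf
  initial := h.apply_zero hT
  approx := by
    refine ⟨fun _ => f, fun _ => y, fun _ => hf, fun _ => ?_, by simp, ?_⟩
    · change IsStrongSolution D F f T (y 0) y
      rw [h.apply_zero hT]; exact h
    · exact Metric.tendstoUniformlyOn_iff.2 fun ε hε =>
        Eventually.of_forall fun _ t _ => by simpa using hε

theorem IsGeneralizedSolution.congr {f g : ℝ → X} {T : ℝ} {x₀ : X} {y : ℝ → X}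
    (h : IsGeneralizedSolution D F f T x₀ y) (hfg : f =ᵐ[volume.restrict (Icc 0 T)] g) :
    IsGeneralizedSolution D F g T x₀ y := by
  obtain ⟨G, z, hG, hz, hGf, hzy⟩ := h.approx
  refine ⟨h.integrableOn.congr hfg, h.initial, G, z, hG, hz, hGf.congr fun k => ?_, hzy⟩
  exact integral_congr_ae (hfg.mono fun t ht => by simp only [ht])

theorem IsGeneralizedSolution.norm_sub_le [CompleteSpace X]
    (hF : ∀ x ∈ D, ∀ y ∈ D, ⟪F x - F y, x - y⟫_ℝ ≤ 0) {f g : ℝ → X} {T : ℝ} {x₀ z₀ : X}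
    {y z : ℝ → X} (hy : IsGeneralizedSolution D F f T x₀ y)
    (hz : IsGeneralizedSolution D F g T z₀ z) {t : ℝ} (ht : t ∈ Icc 0 T) :
    ‖y t - z t‖ ≤ ‖x₀ - z₀‖ + 2 * ∫ s in Icc 0 T, ‖f s - g s‖ := by
  have h0 : (0 : ℝ) ∈ Icc 0 T := ⟨le_rfl, ht.1.trans ht.2⟩
  have hf := hy.integrableOn
  have hg := hz.integrableOn
  obtain ⟨p, η, hp, hη, hpf, hηy⟩ := hy.approx
  obtain ⟨q, ζ, hq, hζ, hqg, hζz⟩ := hz.approx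
  have key : ∀ k, ‖η k t - ζ k t‖ ≤ ‖η k 0 - ζ k 0‖ +
      2 * ((∫ s in Icc 0 T, ‖p k s - f s‖) + (∫ s in Icc 0 T, ‖f s - g s‖) +
        ∫ s in Icc 0 T, ‖q k s - g s‖) := by
    intro k
    refine ((hη k).norm_sub_le hF (hζ k) (hp k) (hq k) ht).trans ?_
    have i1 : IntegrableOn (fun s => ‖p k s - f s‖) (Icc 0 T) := ((hp k).sub hf).norm
    have i2 : IntegrableOn (fun s => ‖f s - g s‖) (Icc 0 T) := (hf.sub hg).norm
    have i3 : IntegrableOn (fun s => ‖q k s - g s‖) (Icc 0 T) := ((hq k).sub hg).norm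
    have i0 : IntegrableOn (fun s => ‖p k s - q k s‖) (Icc 0 T) := ((hp k).sub (hq k)).norm
    have i12 : IntegrableOn (fun s => ‖p k s - f s‖ + ‖f s - g s‖) (Icc 0 T) := i1.add i2
    have i123 : IntegrableOn (fun s => ‖p k s - f s‖ + ‖f s - g s‖ + ‖q k s - g s‖) (Icc 0 T) :=
      i12.add i3
    rw [← integral_add i1 i2, ← integral_add i12 i3]
    refine add_le_add le_rfl (mul_le_mul_of_nonneg_left ?_ zero_le_two)
    refine integral_mono i0 i123 fun s => ?_
    have e : p k s - q k s = (p k s - f s) + (f s - g s) - (q k s - g s) := by abel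
    simp only
    rw [e]
    exact (_root_.norm_sub_le _ _).trans (by gcongr; exact norm_add_le _ _)
  have t1 : Tendsto (fun k => ‖η k t - ζ k t‖) atTop (𝓝 ‖y t - z t‖) :=
    ((hηy.tendsto_at ht).sub (hζz.tendsto_at ht)).norm
  have t2 : Tendsto (fun k => ‖η k 0 - ζ k 0‖) atTop (𝓝 ‖x₀ - z₀‖) := by
    rw [← hy.initial, ← hz.initial]
    exact ((hηy.tendsto_at h0).sub (hζz.tendsto_at h0)).norm
  have t3 := t2.add (((hpf.add (tendsto_const_nhds
    (x := ∫ s in Icc 0 T, ‖f s - g s‖))).add hqg).const_mul 2)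
  rw [zero_add, add_zero] at t3
  exact le_of_tendsto_of_tendsto' t1 t3 key

theorem IsGeneralizedSolution.eqOn [CompleteSpace X]
    (hF : ∀ x ∈ D, ∀ y ∈ D, ⟪F x - F y, x - y⟫_ℝ ≤ 0) {f : ℝ → X} {T : ℝ} {x₀ : X}
    {y z : ℝ → X} (hy : IsGeneralizedSolution D F f T x₀ y)
    (hz : IsGeneralizedSolution D F f T x₀ z) : EqOn z y (Icc 0 T) := fun t ht => by
  have := hz.norm_sub_le hF hy ht
  simp only [sub_self, norm_zero, integral_zero, mul_zero, add_zero] at this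
  exact sub_eq_zero.1 (norm_eq_zero.1 (le_antisymm this (norm_nonneg _)))

/-- Strong solutions from data in D tending to x₀, with the forcing kept fixed, are uniformly Cauchy
by the contraction estimate. -/
theorem IsMDissipative.exists_isGeneralizedSolution [CompleteSpace X] {ι : Type*} [Countable ι]
    (b : HilbertBasis ι ℝ X) (hF : IsMDissipative D F) {f : ℝ → X}
    {L : NNReal} (hf : LipschitzWith L f) {T : ℝ} (hT : 0 ≤ T) {x₀ : X} (hx₀ : x₀ ∈ closure D) :
    ∃ y, IsGeneralizedSolution D F f T x₀ y := by
  have hfi : IntegrableOn f (Icc 0 T) := hf.continuous.integrableOn_Icc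
  obtain ⟨x, hxD, hx⟩ := mem_closure_iff_seq_limit.1 hx₀
  choose y hy using fun k => hF.exists_isStrongSolution b hf hT (hxD k)
  have hyy : ∀ k l, ∀ t ∈ Icc 0 T, ‖y k t - y l t‖ ≤ ‖x k - x l‖ := fun k l t ht => by
    simpa using (hy k).norm_sub_le hF.dissipative (hy l) hfi hfi ht
  have hlim : ∀ t : ℝ, ∃ z, t ∈ Icc 0 T → Tendsto (fun k => y k t) atTop (𝓝 z) := by
    intro t
    by_cases ht : t ∈ Icc 0 T
    · have hc : CauchySeq fun k => y k t := by
        refine Metric.cauchySeq_iff.2 fun ε hε => ?_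
        obtain ⟨n, hn⟩ := Metric.cauchySeq_iff.1 hx.cauchySeq ε hε
        refine ⟨n, fun k hk l hl => lt_of_le_of_lt ?_ (hn k hk l hl)⟩
        rw [dist_eq_norm, dist_eq_norm]
        exact hyy k l t ht
      obtain ⟨z, hz⟩ := cauchySeq_tendsto_of_complete hc
      exact ⟨z, fun _ => hz⟩
    · exact ⟨0, fun h => absurd h ht⟩
  choose z hz using hlim
  have hyz : ∀ k, ∀ t ∈ Icc 0 T, ‖y k t - z t‖ ≤ ‖x k - x₀‖ := fun k t ht =>
    le_of_tendsto_of_tendsto' (tendsto_const_nhds.sub (hz t ht)).norm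
      (tendsto_const_nhds.sub hx).norm fun l => hyy k l t ht
  refine ⟨z, hfi, ?_, fun _ => f, y, fun _ => hfi, fun k => ?_, by simp, ?_⟩
  · refine tendsto_nhds_unique (hz 0 ⟨le_rfl, hT⟩) ?_
    exact hx.congr fun k => ((hy k).apply_zero hT).symm
  · rw [(hy k).apply_zero hT]; exact hy k
  · refine Metric.tendstoUniformlyOn_iff.2 fun ε hε => ?_
    filter_upwards [Metric.tendsto_nhds.1 hx ε hε] with k hk t ht
    rw [dist_comm, dist_eq_norm]
    rw [dist_eq_norm] at hk
    exact (hyz k t ht).trans_lt hk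

end Comparison

/-! ### Galerkin systems and steering inside a Galerkin space. -/

section Galerkin

variable {H : Type*} [NormedAddCommGroup H] [InnerProductSpace ℝ H] {N : ℕ∞}
  (e : HilbertBasis {i : ℕ // (i : ℕ∞) < N} ℝ H)

theorem galerkinSpace_mono : Monotone (galerkinSpace e) := fun _ _ h =>
  Submodule.span_mono (image_mono fun _ hi => lt_of_lt_of_le hi h)

theorem galerkinProj_mem (n : ℕ) (x : H) : galerkinProj e n x ∈ galerkinSpace e n :=
  Submodule.starProjection_apply_mem _ x

theorem galerkinProj_eq_self {n : ℕ} {x : H} (hx : x ∈ galerkinSpace e n) :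
    galerkinProj e n x = x :=
  Submodule.starProjection_eq_self_iff.2 hx

theorem norm_galerkinProj_le (n : ℕ) (x : H) : ‖galerkinProj e n x‖ ≤ ‖x‖ :=
  Submodule.norm_starProjection_apply_le _ x

theorem tendsto_galerkinProj (x : H) : Tendsto (fun n => galerkinProj e n x) atTop (𝓝 x) := by
  refine Submodule.starProjection_tendsto_self _ (galerkinSpace_mono e) x ?_
  rw [← e.dense_span]
  refine Submodule.topologicalClosure_mono (Submodule.span_le.2 ?_)
  rintro _ ⟨i, rfl⟩
  exact Submodule.mem_iSup_of_mem ((i : ℕ) + 1)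
    (Submodule.subset_span ⟨i, Nat.lt_succ_self _, rfl⟩)

theorem inner_galerkinProj_sub_le {D : Set H} {F : H → H}
    (hF : ∀ x ∈ D, ∀ y ∈ D, ⟪F x - F y, x - y⟫_ℝ ≤ 0) {n : ℕ}
    (hD : (galerkinSpace e n : Set H) ⊆ D) :
    ∀ x ∈ (galerkinSpace e n : Set H), ∀ y ∈ (galerkinSpace e n : Set H),
      ⟪galerkinProj e n (F x) - galerkinProj e n (F y), x - y⟫_ℝ ≤ 0 := by
  intro x hx y hy
  have h := hF x (hD hx) y (hD hy)
  rw [← map_sub, galerkinProj, Submodule.inner_starProjection_left_eq_right,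
    Submodule.starProjection_eq_self_iff.2 (Submodule.sub_mem _ hx hy)]
  exact h

/-- Solvability of the Galerkin system for Lipschitz forcing. -/
theorem exists_isStrongSolution_galerkin [CompleteSpace H] {D : Set H} {F : H → H}
    (hF : ∀ x ∈ D, ∀ y ∈ D, ⟪F x - F y, x - y⟫_ℝ ≤ 0) {n : ℕ}
    (hD : (galerkinSpace e n : Set H) ⊆ D)
    (hcont : ContinuousOn (fun x => galerkinProj e n (F x)) (galerkinSpace e n))
    {f : ℝ → H} {L : NNReal} (hf : LipschitzWith L f) {T : ℝ} (hT : 0 ≤ T) {x₀ : H}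
    (hx₀ : x₀ ∈ galerkinSpace e n) :
    ∃ y, IsStrongSolution (galerkinSpace e n) (fun x => galerkinProj e n (F x))
      (fun t => galerkinProj e n (f t)) T x₀ y := by
  let V := galerkinSpace e n
  let G : V → V := fun x => ⟨galerkinProj e n (F x), galerkinProj_mem e n _⟩
  have hG : Continuous G := Continuous.subtype_mk
    (continuousOn_iff_continuous_domRestrict.1 hcont) _
  have hGd : ∀ x y, ⟪G x - G y, x - y⟫_ℝ ≤ 0 := fun x y =>
    inner_galerkinProj_sub_le e hF hD x x.2 y y.2
  let φ : ℝ → V := fun t => ⟨galerkinProj e n (f t), galerkinProj_mem e n _⟩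
  have hφ : LipschitzWith L φ := LipschitzWith.of_dist_le_mul fun s t => by
    refine le_trans ?_ (hf.dist_le_mul s t)
    rw [Subtype.dist_eq, dist_eq_norm, dist_eq_norm]
    simp only [φ]
    rw [← map_sub]
    exact norm_galerkinProj_le e n _
  obtain ⟨y, hy⟩ := (isMDissipative_univ_of_continuous hG hGd).exists_isStrongSolution
    (stdOrthonormalBasis ℝ V).toHilbertBasis hφ hT (mem_univ (⟨x₀, hx₀⟩ : V))
  refine ⟨fun t => y t, ae_of_all _ fun t => (y t).2, ?_, fun t ht => ?_⟩
  · exact V.subtypeL.integrable_comp hy.integrableOn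
  · have hsub : uIcc 0 t ⊆ Icc 0 T := by rw [uIcc_of_le ht.1]; exact Icc_subset_Icc_right ht.2
    have h1 := congrArg V.subtypeL (hy.eq_integral t ht)
    rw [map_add, ← V.subtypeL.intervalIntegral_comp_comm
      (hy.integrableOn.mono_set hsub).intervalIntegrable] at h1
    exact h1

theorem denseRange_of_adjoint_injective [CompleteSpace H] {E : Type*} [NormedAddCommGroup E]
    [InnerProductSpace ℝ E] [CompleteSpace E] {B : E →L[ℝ] H}
    (hB : ∀ h : H, ContinuousLinearMap.adjoint B h = 0 → h = 0) : DenseRange B := by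
  have h1 : B.rangeᗮ = ⊥ := by
    rw [ContinuousLinearMap.orthogonal_range]
    exact LinearMap.ker_eq_bot'.2 hB
  have h2 := Submodule.topologicalClosure_eq_top_iff.2 h1
  have h3 := Submodule.dense_iff_topologicalClosure_eq_top.2 h2
  exact h3

/-- P_n B has dense range in the finite-dimensional E_n, where subspaces are closed, so it is onto
and splits continuously. -/
theorem exists_rightInverse_galerkinProj_comp {E : Type*} [NormedAddCommGroup E]
    [NormedSpace ℝ E] {B : E →L[ℝ] H} (hB : DenseRange B) (n : ℕ) :
    ∃ R : galerkinSpace e n →L[ℝ] E, ∀ x, galerkinProj e n (B (R x)) = x := by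
  let V := galerkinSpace e n
  let A : E →ₗ[ℝ] V := (V.orthogonalProjectionOnto.comp B : E →L[ℝ] V)
  have hA : Function.Surjective A := by
    have hd : DenseRange A := by
      refine DenseRange.comp (g := V.orthogonalProjectionOnto) ?_ hB
        V.orthogonalProjectionOnto.continuous
      exact Function.Surjective.denseRange fun x => ⟨x, by simp⟩
    have hc : IsClosed (A.range : Set V) := Submodule.closed_of_finiteDimensional _
    have : closure (range A) = range A := hc.closure_eq
    exact range_eq_univ.1 (this ▸ hd.closure_range)
  obtain ⟨R, hR⟩ := A.exists_rightInverse_of_surjective (LinearMap.range_eq_top.2 hA)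
  refine ⟨LinearMap.toContinuousLinearMap R, fun x => ?_⟩
  exact congrArg Subtype.val (LinearMap.congr_fun hR x)

/-- The Galerkin systems are exactly controllable. -/
theorem exists_control_galerkin [CompleteSpace H] {E : Type*} [NormedAddCommGroup E] [NormedSpace ℝ E]
    {B : E →L[ℝ] H} (hB : DenseRange B) {F : H → H} {n : ℕ}
    (hcont : ContinuousOn (fun x => galerkinProj e n (F x)) (galerkinSpace e n))
    {T : ℝ} (hT : 0 < T) {a b : H} (ha : a ∈ galerkinSpace e n) (hb : b ∈ galerkinSpace e n) :
    ∃ (u : ℝ → E) (y : ℝ → H), Continuous u ∧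
      IsStrongSolution (galerkinSpace e n) (fun x => galerkinProj e n (F x))
        (fun t => galerkinProj e n (B (u t))) T a y ∧ y T = b := by
  obtain ⟨R, hR⟩ := exists_rightInverse_galerkinProj_comp e hB n
  -- The constant velocity of the straight path from a to b; the control below, R(c − F_n y),
  -- cancels the drift and is continuous because F_n is.
  let c : galerkinSpace e n := ⟨T⁻¹ • (b - a), Submodule.smul_mem _ _ (Submodule.sub_mem _ hb ha)⟩
  let y : ℝ → galerkinSpace e n := fun t => ⟨a, ha⟩ + t • c
  have hy : Continuous y := by fun_prop
  let G : galerkinSpace e n → galerkinSpace e n := fun x =>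
    ⟨galerkinProj e n (F x), galerkinProj_mem e n _⟩
  have hG : Continuous G := Continuous.subtype_mk
    (continuousOn_iff_continuous_domRestrict.1 hcont) _
  have hsum : ∀ t, galerkinProj e n (F (y t)) +
      galerkinProj e n (B (R (c - G (y t)))) = c := fun t => by
    rw [hR]; simp [G]
  refine ⟨fun t => R (c - G (y t)), fun t => y t,
    R.continuous.comp (continuous_const.sub (hG.comp hy)),
    ⟨ae_of_all _ fun t => (y t).2, ?_, fun t _ => ?_⟩, ?_⟩
  · simp only [hsum]
    exact integrableOn_const (by simp)
  · simp only [hsum]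
    simp [y]
  · simp only [y, c, Submodule.coe_add, Submodule.coe_smul]
    rw [smul_inv_smul₀ hT.ne', add_sub_cancel]

/-- Any two points of a Galerkin space are joined, inside that space, by a strong solution of the
full equation with integrable forcing. -/
theorem exists_isStrongSolution_galerkinSpace [CompleteSpace H] {D : Set H} {F : H → H} {m : ℕ}
    (hD : (galerkinSpace e m : Set H) ⊆ D)
    (hcont : ∀ n : ℕ, ContinuousOn (fun x => galerkinProj e n (F x)) (galerkinSpace e n))
    {T : ℝ} (hT : 0 < T) {a b : H} (ha : a ∈ galerkinSpace e m) (hb : b ∈ galerkinSpace e m) :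
    ∃ z g : ℝ → H, (∀ t, z t ∈ galerkinSpace e m) ∧ IntegrableOn g (Icc 0 T) ∧
      IsStrongSolution D F g T a z ∧ z T = b := by
  let w : ℝ → H := fun s => a + s • (b - a)
  have hwc : Continuous w := by fun_prop
  have hw : ∀ s, w s ∈ galerkinSpace e m := fun s =>
    Submodule.add_mem _ ha (Submodule.smul_mem _ _ (Submodule.sub_mem _ hb ha))
  -- `F` itself may be discontinuous on the segment. The shift n + m keeps the segment inside
  -- E_{n+m}, where P_{n+m}F is continuous.
  have hFw : StronglyMeasurable fun s => F (w s) := by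
    refine stronglyMeasurable_of_tendsto atTop
      (f := fun n s => galerkinProj e (n + m) (F (w s))) (fun n => ?_) ?_
    · exact ((hcont (n + m)).comp_continuous hwc fun s =>
        galerkinSpace_mono e (Nat.le_add_left m n) (hw s)).stronglyMeasurable
    · exact tendsto_pi_nhds.2 fun s =>
        (tendsto_galerkinProj e (F (w s))).comp (tendsto_add_atTop_nat m)
  obtain ⟨σ, v, hσc, hv, hσ, hσT, hφσ⟩ := exists_timeChange_integrableOn_comp
    (φ := fun s => ‖F (w s)‖) hFw.norm.measurable (fun s => norm_nonneg _) hT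
  have hFσ : IntegrableOn (fun t => F (w (σ t))) (Icc 0 T) := by
    refine (integrable_norm_iff ?_).1 hφσ
    exact (hFw.comp_measurable hσc.measurable).aestronglyMeasurable
  have hvb : IntegrableOn (fun t => v t • (b - a)) (Icc 0 T) := hv.smul_const _
  refine ⟨fun t => w (σ t), fun t => v t • (b - a) - F (w (σ t)), fun t => hw _, hvb.sub hFσ,
    ⟨ae_of_all _ fun t => hD (hw _), ?_, fun t ht => ?_⟩, ?_⟩
  · simpa using hvb
  · simp only [add_sub_cancel]
    rw [intervalIntegral.integral_smul_const, ← hσ t ht]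
  · simp [w, hσT]

/-- P_n fixes a curve lying in E_n, so projecting its equation alters only the F-term and the
forcing. -/
theorem IsStrongSolution.galerkin [CompleteSpace H] {D : Set H} {F : H → H} {n : ℕ} {g z : ℝ → H}
    {T : ℝ} {a : H} (hz : IsStrongSolution D F g T a z) (ha : a ∈ galerkinSpace e n)
    (hmem : ∀ t, z t ∈ galerkinSpace e n) :
    IsStrongSolution (galerkinSpace e n) (fun x => galerkinProj e n (F x))
      (fun t => galerkinProj e n (g t)) T a z := by
  refine ⟨ae_of_all _ hmem, ?_, fun t ht => ?_⟩
  · simp only [← map_add]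
    exact (galerkinProj e n).integrable_comp hz.integrableOn
  · have hsub : uIcc 0 t ⊆ Icc 0 T := by rw [uIcc_of_le ht.1]; exact Icc_subset_Icc_right ht.2
    have h1 := congrArg (galerkinProj e n) (hz.eq_integral t ht)
    rw [map_add, ← (galerkinProj e n).intervalIntegral_comp_comm
      (hz.integrableOn.mono_set hsub).intervalIntegrable, galerkinProj_eq_self e (hmem t),
      galerkinProj_eq_self e ha] at h1
    simpa only [map_add] using h1

end Galerkin

/-! ### Assembly of the controls. -/

theorem memLp_two_restrict_Icc_of_continuous {E : Type*} [NormedAddCommGroup E] {u : ℝ → E}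
    (hu : Continuous u) (T : ℝ) : MemLp u 2 (volume.restrict (Icc 0 T)) := by
  obtain ⟨C, hC⟩ := (isCompact_Icc (a := (0 : ℝ)) (b := T)).exists_bound_of_continuousOn
    hu.continuousOn
  exact MemLp.of_bound hu.aestronglyMeasurable C
    ((ae_restrict_mem measurableSet_Icc).mono hC)

/-- Approximate controllability through Galerkin approximations. For `n : ℕ`, the Galerkin operator
`F_n = P_n F|_{E_n}` is the map `x ↦ P_n (F x)` with domain `E_n`. -/
theorem lemmaA1
    {H : Type*} [NormedAddCommGroup H] [InnerProductSpace ℝ H] [CompleteSpace H]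
    {E : Type*} [NormedAddCommGroup E] [InnerProductSpace ℝ E] [CompleteSpace E]
    (D : Set H) (F : H → H) (hF : IsMDissipative D F)
    (B : E →L[ℝ] H) (hB : ∀ h : H, ContinuousLinearMap.adjoint B h = 0 → h = 0)
    {N : ℕ∞} (e : HilbertBasis {i : ℕ // (i : ℕ∞) < N} ℝ H)
    (hD : ∀ n : ℕ, (galerkinSpace e n : Set H) ⊆ D)
    (hcont : ∀ n : ℕ, ContinuousOn (fun x => galerkinProj e n (F x)) (galerkinSpace e n))
    (T : ℝ) (hT : 0 < T) :
    ∃ δ : ℝ → ℝ, Tendsto δ (𝓝[>] 0) (𝓝 0) ∧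
      ∀ ε : ℝ, 0 < ε → ∀ y₀ ∈ closure D, ∀ y₁ ∈ closure D,
        ∃ (u : ℕ → Lp E 2 ((volume : Measure ℝ).restrict (Icc 0 T)))
          (uLim : Lp E 2 ((volume : Measure ℝ).restrict (Icc 0 T))),
          Tendsto u atTop (𝓝 uLim) ∧
          (∀ n : ℕ, ∃ y : ℝ → H,
            IsStrongSolution (galerkinSpace e n) (fun x => galerkinProj e n (F x))
              (fun t => galerkinProj e n (B (u n t))) T (galerkinProj e n y₀) y ∧
            (∀ z : ℝ → H,
              IsStrongSolution (galerkinSpace e n) (fun x => galerkinProj e n (F x))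
                (fun t => galerkinProj e n (B (u n t))) T (galerkinProj e n y₀) z →
              EqOn z y (Icc 0 T)) ∧
            ‖y T - galerkinProj e n y₁‖ ≤ δ ε) ∧
          (∃ y : ℝ → H,
            IsGeneralizedSolution D F (fun t => B (uLim t)) T y₀ y ∧
            (∀ z : ℝ → H,
              IsGeneralizedSolution D F (fun t => B (uLim t)) T y₀ z → EqOn z y (Icc 0 T)) ∧
            ‖y T - y₁‖ ≤ δ ε) := by

  have hmono := hF.dissipative
  have hBd : DenseRange B := denseRange_of_adjoint_injective hB
  have hDn := fun n => inner_galerkinProj_sub_le e hmono (hD n)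
  refine ⟨id, tendsto_id.mono_left nhdsWithin_le_nhds, fun ε hε y₀ hy₀ y₁ hy₁ => ?_⟩
  have hP : ∀ x : H, ∀ᶠ n in atTop, ‖x - galerkinProj e n x‖ < ε / 8 := fun x => by
    filter_upwards [Metric.tendsto_nhds.1 (tendsto_galerkinProj e x) (ε / 8) (by positivity)]
      with n hn
    rwa [dist_comm, dist_eq_norm] at hn
  -- Error budget: ε/8 from the initial point, 2 · ε/8 from the forcing and ε/8 from the target, at
  -- most ε/2 in all.
  obtain ⟨m, hm₀, hm₁⟩ := ((hP y₀).and (hP y₁)).exists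
  set a := galerkinProj e m y₀ with ha
  set b := galerkinProj e m y₁ with hb
  have ham : a ∈ galerkinSpace e m := galerkinProj_mem e m y₀
  have hbm : b ∈ galerkinSpace e m := galerkinProj_mem e m y₁
  obtain ⟨z, g, hzm, hg, hz, hzT⟩ := exists_isStrongSolution_galerkinSpace e (hD m) hcont hT ham hbm
  obtain ⟨w, L, hw, hgw⟩ := exists_lipschitzWith_integral_norm_sub_le B hBd hT hg
    (η := ε / 8) (by positivity)
  have hBw : LipschitzWith (‖B‖₊ * L) fun t => B (w t) := B.lipschitz.comp hw
  have hBwi : IntegrableOn (fun t => B (w t)) (Icc 0 T) := hBw.continuous.integrableOn_Icc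
  have hgw' : ∫ t in Icc 0 T, ‖B (w t) - g t‖ ≤ ε / 8 := by
    simpa only [norm_sub_rev] using hgw
  have hTT : T ∈ Icc 0 T := ⟨hT.le, le_rfl⟩
  -- One control `w` for all n ≥ m; the exact controls used for n < m do not affect the limit.
  have hgal : ∀ n, ∃ (u : ℝ → E) (y : ℝ → H), Continuous u ∧ (m ≤ n → u = w) ∧
      IsStrongSolution (galerkinSpace e n) (fun x => galerkinProj e n (F x))
        (fun t => galerkinProj e n (B (u t))) T (galerkinProj e n y₀) y ∧
      ‖y T - galerkinProj e n y₁‖ ≤ ε := by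
    intro n
    rcases lt_or_ge n m with hnm | hmn
    · obtain ⟨u, y, hu, hy, hyT⟩ := exists_control_galerkin e hBd (hcont n) hT
        (galerkinProj_mem e n y₀) (galerkinProj_mem e n y₁)
      exact ⟨u, y, hu, fun h => absurd h (not_le.2 hnm), hy, by simp [hyT, hε.le]⟩
    · obtain ⟨y, hy⟩ := exists_isStrongSolution_galerkin e hmono (hD n) (hcont n) hBw hT.le
        (galerkinProj_mem e n y₀)
      have han := galerkinSpace_mono e hmn ham
      have hbn := galerkinSpace_mono e hmn hbm
      have hzn := hz.galerkin e han fun t => galerkinSpace_mono e hmn (hzm t)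
      have hd := hy.norm_sub_le (hDn n) hzn ((galerkinProj e n).integrable_comp hBwi)
        ((galerkinProj e n).integrable_comp hg) hTT
      have h1 : ‖galerkinProj e n y₀ - a‖ ≤ ε / 8 := by
        -- As a ∈ E_n, the difference is P_n(y₀ − a), which is no longer than y₀ − a.
        rw [← galerkinProj_eq_self e han, ← map_sub]
        exact (norm_galerkinProj_le e n _).trans hm₀.le
      have h2 : ‖b - galerkinProj e n y₁‖ ≤ ε / 8 := by
        rw [norm_sub_rev, ← galerkinProj_eq_self e hbn, ← map_sub]
        exact (norm_galerkinProj_le e n _).trans hm₁.le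
      have h3 : ∫ t in Icc 0 T, ‖galerkinProj e n (B (w t)) - galerkinProj e n (g t)‖ ≤ ε / 8 := by
        refine le_trans (integral_mono ?_ (hBwi.sub hg).norm fun t => ?_) hgw'
        · exact (((galerkinProj e n).integrable_comp hBwi).sub
            ((galerkinProj e n).integrable_comp hg)).norm
        · simp only [Pi.sub_apply]
          rw [← map_sub]
          exact norm_galerkinProj_le e n _
      refine ⟨w, y, hw.continuous, fun _ => rfl, hy, ?_⟩
      rw [hzT] at hd
      have h4 := norm_sub_le_norm_sub_add_norm_sub (y T) b (galerkinProj e n y₁)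
      linarith
  choose u y hu huw hy hyT using hgal
  have hLp : ∀ {v : ℝ → E} (hv : Continuous v),
      v =ᵐ[volume.restrict (Icc 0 T)] (memLp_two_restrict_Icc_of_continuous hv T).toLp v :=
    fun hv => (MemLp.coeFn_toLp _).symm
  refine ⟨fun n => (memLp_two_restrict_Icc_of_continuous (hu n) T).toLp (u n),
    (memLp_two_restrict_Icc_of_continuous hw.continuous T).toLp w, ?_, fun n => ?_, ?_⟩
  · refine tendsto_const_nhds.congr' ?_
    filter_upwards [eventually_ge_atTop m] with n hn
    exact MemLp.toLp_congr _ _ (by rw [huw n hn])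
  -- An `Lp` class has its own representative, equal to the continuous control only almost
  -- everywhere; uniqueness comes from that of generalized solutions.
  · have hae : (fun t => galerkinProj e n (B (u n t))) =ᵐ[volume.restrict (Icc 0 T)] fun t =>
        galerkinProj e n (B ((memLp_two_restrict_Icc_of_continuous (hu n) T).toLp (u n) t)) :=
      (hLp (hu n)).mono fun t ht => congrArg (fun x => galerkinProj e n (B x)) ht
    have hi : IntegrableOn (fun t => galerkinProj e n (B (u n t))) (Icc 0 T) :=
      ((galerkinProj e n).continuous.comp (B.continuous.comp (hu n))).integrableOn_Icc
    exact ⟨y n, (hy n).congr hae, fun x hx =>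
      ((hy n).isGeneralizedSolution hT.le hi).eqOn (hDn n)
        ((hx.congr hae.symm).isGeneralizedSolution hT.le hi), hyT n⟩
  · obtain ⟨Y, hY⟩ := hF.exists_isGeneralizedSolution e hBw hT.le hy₀
    have hae : (fun t => B (w t)) =ᵐ[volume.restrict (Icc 0 T)] fun t =>
        B ((memLp_two_restrict_Icc_of_continuous hw.continuous T).toLp w t) :=
      (hLp hw.continuous).mono fun t ht => congrArg B ht
    refine ⟨Y, hY.congr hae, fun x hx => (hY.congr hae).eqOn hmono hx, ?_⟩
    have hd := hY.norm_sub_le hmono (hz.isGeneralizedSolution hT.le hg) hTT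
    rw [hzT] at hd
    have h4 := norm_sub_le_norm_sub_add_norm_sub (Y T) b y₁
    have h5 : ‖b - y₁‖ < ε / 8 := by rwa [norm_sub_rev]
    simp only [id]
    linarith
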